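/- Model. Let $G=(V,E)$ be a finite, simple, undirected, connected graph with $n=|V|$ nodes and maximum degree $\Delta$. Nodes are anonymous and have no memory. At each node $v$ the incident edges carry distinct port labels $1,\dots,\deg(v)$; the two labels of an edge are unrelated. There are $k\le n$ agents with pairwise distinct identifiers in $\{1,\dots,k^{c}\}$, where $c$ is a constant. Time proceeds in synchronous rounds. In each round every agent observes the degree of its current node, its own state and the states of all agents at the same node (local communication); from these data alone it computes, by an arbitrary deterministic computation, the new contents of its memory and a port through which it leaves the node (or it stays). An agent that moves learns the port label, at the new node, of the edge through which it arrived. All agents run the same algorithm and initially know only their own identifiers; in particular $n$, $k$, $\Delta$ and $c$ are not given to them. The memory of an agent is the number of bits it keeps from one round to the next (identifier, incoming port, outgoing port and all other variables); memory used only during the computation within a round is free. Dispersion is solved within $T$ rounds if after some $t\le T$ rounds the agents are on pairwise distinct nodes and no agent moves afterwards. Theorem. There are a deterministic algorithm in this model (RootedSyncDisp) and a constant $C$ such that for every constant $c$ there is a constant $M$ with the following property. For every connected port-labeled graph $G$ with $n$ nodes and maximum degree $\Delta$, every $k\le n$, every node $s$, and every assignment of distinct identifiers in $\{1,\dots,k^{c}\}$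 to $k$ agents that are all initially located at $s$, the algorithm solves dispersion within $C\,k$ rounds, and at every time every agent stores at most $M\,(\lfloor\log_2(k+\Delta)\rfloor+1)$ bits. That is, the algorithm takes $O(k)$ rounds and $O(\log(k+\Delta))$ bits per agent. -/

import Mathlib

/-- A port labeling of `G`: at each node `v` the incident edges carry the distinct labels
`1, …, deg v`. The two labels of an edge (one at each endpoint) are unrelated. -/
abbrev PortLabeling {V : Type*} [Fintype V] (G : SimpleGraph V) [DecidableRel G.Adj] : Type _ :=
  ∀ v : V, G.neighborSet v ≃ Set.Icc 1 (G.degree v)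

namespace PortLabeling

variable {V : Type*} [Fintype V] {G : SimpleGraph V} [DecidableRel G.Adj]

/-- `N(v, i)`: the neighbour of `v` behind port `i`. The value `0` stands for `⊥`, "no port";
if `i` is not a port of `v` then `N(v, i) = v`. -/
def nbr (p : PortLabeling G) (v : V) (i : ℕ) : V :=
  if h : i ∈ Set.Icc 1 (G.degree v) then ((p v).symm ⟨i, h⟩ : V) else v

/-- `p_v(u)`: the label at `v` of the edge `{v, u}` (and `0` if there is no such edge). -/
def label (p : PortLabeling G) (v u : V) : ℕ :=
  if h : G.Adj v u then (p v ⟨u, h⟩ : ℕ) else 0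

end PortLabeling

/-- Everything an agent keeps from one round to the next: its identifier, its incoming port,
its outgoing port (`0` is `⊥` for both), and a string of bits. -/
structure AgentState where
  id : ℕ
  pin : ℕ
  pout : ℕ
  mem : List Bool
deriving DecidableEq

/-- The number of bits stored at an agent (numbers are stored in binary). -/
def AgentState.bits (a : AgentState) : ℕ :=
  a.id.size + a.pin.size + a.pout.size + a.mem.length

/-- A deterministic algorithm for agents with local communication. It is one and the same rule for
all agents, nodes, graphs and numbers of agents. From the degree of the current node, the agent's
own state, and the states of all agents at the current node (itself included), it computes, by an
arbitrary computation, the agent's new memory and the port through which the agent leaves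
(`0`: it stays).
What a co-located agent would write into this agent's memory depends on the same data, so such
writes are part of `compute`. -/
structure SyncAlgorithm where
  compute : (deg : ℕ) → (self : AgentState) → (here : Finset AgentState) → List Bool × ℕ

/-- The positions and the states of `k` agents. -/
structure Config (V : Type*) (k : ℕ) where
  pos : Fin k → V
  state : Fin k → AgentState

namespace Config

variable {V : Type*} {k : ℕ}

/-- All agents are at the node `s`; an agent knows its identifier and nothing else. -/
def rooted (s : V) (ID : Fin k → ℕ) : Config V k where
  pos _ := s
  state i := { id := ID i, pin := 0, pout := 0, mem := [] }

/-- The states of the agents located at the node of agent `i`. -/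
def view [DecidableEq V] (c : Config V k) (i : Fin k) : Finset AgentState :=
  (Finset.univ.filter fun j => c.pos j = c.pos i).image c.state

/-- The agents are on pairwise distinct nodes. -/
def IsDispersion (c : Config V k) : Prop :=
  Function.Injective c.pos

end Config

namespace SyncAlgorithm

variable {V : Type*} [Fintype V] [DecidableEq V] {G : SimpleGraph V} [DecidableRel G.Adj] {k : ℕ}

/-- One synchronous round: all agents simultaneously communicate, compute and move. The incoming
port is updated when the agent moves. -/
def step (A : SyncAlgorithm) (p : PortLabeling G) (c : Config V k) : Config V k :=
  let out : Fin k → List Bool × ℕ := fun i =>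
    A.compute (G.degree (c.pos i)) (c.state i) (c.view i)
  let newPos : Fin k → V := fun i => p.nbr (c.pos i) (out i).2
  { pos := newPos
    state := fun i =>
      { id := (c.state i).id
        pin := if newPos i = c.pos i then (c.state i).pin else p.label (newPos i) (c.pos i)
        pout := (out i).2
        mem := (out i).1 } }

/-- The configuration after `t` rounds. -/
def run (A : SyncAlgorithm) (p : PortLabeling G) (c : Config V k) (t : ℕ) : Config V k :=
  (A.step p)^[t] c

/-- Within `T` rounds a dispersion configuration is reached, and from then on no agent moves. -/
def SolvesDispersionWithin (A : SyncAlgorithm) (p : PortLabeling G) (c : Config V k) (T : ℕ) :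
    Prop :=
  ∃ t ≤ T, (A.run p c t).IsDispersion ∧ ∀ t' ≥ t, (A.run p c t').pos = (A.run p c t).pos

/-- At every time every agent stores at most `B` bits. -/
def UsesMemory (A : SyncAlgorithm) (p : PortLabeling G) (c : Config V k) (B : ℕ) : Prop :=
  ∀ (t : ℕ) (i : Fin k), ((A.run p c t).state i).bits ≤ B

end SyncAlgorithm

/-! The agents rank themselves by identifier, and a shrinking group explores the graph depth first
for `2 * k` steps of 32 rounds each. Nodes have no memory and settling an agent at every new node
would be too slow to detect, so visited nodes are guarded by patrollers: the agent of rank `r`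
leaves the group after step `4 * r + 4`, remembers steps `4 * r + 1, …, 4 * r + 4`, and swings along
this segment, back and forth in ten rounds. Thus a node has been visited exactly when a prober
waiting there for nine rounds meets a patroller (`exists_patrol`).

In a step the agents not yet patrolling stay home for one batch, to hear from passing patrollers the
port to the DFS parent, and then probe two ports each. This is constant time and suffices. While
fewer than `k` nodes are visited, a node with an unvisited neighbour has one behind one of its first
`k - 1` ports (`exists_port`), and at most about half of the agents patrol, because there are only
`2 * k` steps and each patroller covers four of them. The group then moves to an unvisited neighbour
or back to the parent (`isDFSStep`).

While fewer than `k` nodes are visited, each discovery lengthens the DFS stack and each return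
shortens it, so twice the number of visited nodes is the number of steps plus the stack length plus
a constant. Hence `k` nodes are found within `2 * k` steps (`IsDFSWalk.complete`). The walk is then
undone from the recorded segments, one step per round; the agent of rank `r` stops at the node with
index `r` (`retreat_succ`, `final_injective`). It is never needed as a guide after that, since node
`r` is discovered by step `2 * r - 1`, before its own segment begins.

An agent keeps a bounded number of ports, counters and ranks, which gives the logarithmic memory
(`usesMemory`). -/

namespace RootedDispersion

/-! ### Storing a list of numbers as a bit string -/

/-- Self-delimiting code of a list of bit strings. -/
def packWords : List (List Bool) → List Bool
  | [] => []
  | [] :: ls => false :: packWords ls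
  | (b :: bs) :: ls => true :: b :: packWords (bs :: ls)
termination_by l => (l.map fun w => w.length + 1).sum

/-- Every letter is announced by `true` and every word closed by `false`, so the first bit always
decides which constructor was encoded. -/
theorem packWords_injective : Function.Injective packWords := by
  intro l
  induction l using packWords.induct with
  | case1 =>
    intro l' h
    match l' with
    | [] => rfl
    | [] :: ls => simp [packWords] at h
    | (b :: bs) :: ls => simp [packWords] at h
  | case2 ls ih =>
    intro l' h
    match l' with
    | [] => simp [packWords] at h
    | [] :: ls' => simp only [packWords, List.cons.injEq, true_and] at h; rw [ih h]
    | (b :: bs) :: ls' => simp [packWords] at h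
  | case3 b bs ls ih =>
    intro l' h
    match l' with
    | [] => simp [packWords] at h
    | [] :: ls' => simp [packWords] at h
    | (b' :: bs') :: ls' =>
      simp only [packWords, List.cons.injEq, true_and] at h
      have := ih h.2
      simp only [List.cons.injEq] at this
      rw [h.1, this.1, this.2]

theorem length_packWords (l : List (List Bool)) :
    (packWords l).length = (l.map fun w => 2 * w.length + 1).sum := by
  induction l using packWords.induct with
  | case1 => simp [packWords]
  | case2 ls ih => simp [packWords, ih]; omega
  | case3 b bs ls ih => simp [packWords, ih]; omega

theorem bits_injective : Function.Injective Nat.bits := by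
  intro a
  induction a using Nat.binaryRec' with
  | zero =>
    intro b h
    have := congrArg List.length h
    rw [Nat.size_eq_bits_len, Nat.size_eq_bits_len, Nat.size_zero] at this
    exact (Nat.size_eq_zero.mp this.symm).symm
  | bit b n hb ih =>
    intro c h
    induction c using Nat.binaryRec' with
    | zero =>
      have := congrArg List.length h
      rw [Nat.size_eq_bits_len, Nat.size_eq_bits_len, Nat.size_zero] at this
      exact Nat.size_eq_zero.mp this
    | bit b' n' hb' _ =>
      rw [Nat.bits_append_bit _ _ hb, Nat.bits_append_bit _ _ hb', List.cons.injEq] at h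
      rw [h.1, ih h.2]

/-- Binary code of a list of numbers. -/
def packNats (l : List ℕ) : List Bool := packWords (l.map Nat.bits)

theorem packNats_injective : Function.Injective packNats := fun _ _ h =>
  (List.map_injective_iff.mpr bits_injective) (packWords_injective h)

theorem length_packNats_le (l : List ℕ) (N : ℕ) (h : ∀ n ∈ l, n ≤ N) :
    (packNats l).length ≤ l.length * (2 * N.size + 1) := by
  rw [packNats, length_packWords, List.map_map]
  refine (List.sum_le_card_nsmul _ (2 * N.size + 1) ?_).trans (by simp)
  intro x hx
  obtain ⟨n, hn, rfl⟩ := List.mem_map.mp hx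
  simp only [Function.comp, Nat.size_eq_bits_len]
  have := Nat.size_le_size (h n hn)
  omega

/-! ### The memory of an agent -/

/-- One step of the walk of the group: the port through which the group left, the port through
which it arrived, and the index of the node reached if that node was new (`0` otherwise). -/
structure Entry where
  out : ℕ
  inn : ℕ
  idx : ℕ

instance : Inhabited Entry := ⟨⟨0, 0, 0⟩⟩

/-- The variables of an agent: number of agents (`0` before the first round), rank of the agent,
clock, number of nodes discovered, index of the node just discovered, port being probed, port
towards the DFS parent of the current node, port towards an undiscovered neighbour, whether a
patroller was met at the probed node, whether the agent has settled, and the latest steps of the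
walk, most recent first. -/
structure Mem where
  k : ℕ
  rk : ℕ
  t : ℕ
  x : ℕ
  nw : ℕ
  tgt : ℕ
  pp : ℕ
  cand : ℕ
  saw : Bool
  st : Bool
  hist : List Entry

instance : Inhabited Mem := ⟨⟨0, 0, 0, 0, 0, 0, 0, 0, false, false, []⟩⟩

namespace Mem

def histNats (l : List Entry) : List ℕ := l.flatMap fun e => [e.out, e.inn, e.idx]

theorem histNats_injective : Function.Injective histNats := by
  intro l
  induction l with
  | nil => intro l' h; cases l' <;> simp_all [histNats]
  | cons e l ih =>
    intro l' h
    cases l' with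
    | nil => simp [histNats] at h
    | cons e' l' =>
      simp only [histNats, List.flatMap_cons, List.cons_append, List.nil_append,
        List.cons.injEq] at h
      obtain ⟨h1, h2, h3, h4⟩ := h
      rw [ih h4]
      cases e; cases e'; simp_all

def toNats (a : Mem) : List ℕ :=
  [a.k, a.rk, a.t, a.x, a.nw, a.tgt, a.pp, a.cand, a.saw.toNat, a.st.toNat] ++ histNats a.hist

theorem toNat_injective : Function.Injective Bool.toNat := by
  intro a b h
  cases a <;> cases b <;> simp_all

theorem toNats_injective : Function.Injective toNats := by
  intro a b h
  simp only [toNats, List.cons_append, List.nil_append, List.cons.injEq] at h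
  obtain ⟨h1, h2, h3, h4, h5, h6, h7, h8, h9, h10, h11⟩ := h
  have h9 := toNat_injective h9
  have h10 := toNat_injective h10
  have h11 := histNats_injective h11
  cases a; cases b; simp_all

def encode (a : Mem) : List Bool := packNats a.toNats

theorem encode_injective : Function.Injective encode :=
  packNats_injective.comp toNats_injective

-- Computation within a round is unrestricted, so an inverse obtained by choice is enough.
open Classical in
noncomputable def decode (l : List Bool) : Mem :=
  if h : ∃ a, encode a = l then h.choose else default

@[simp] theorem decode_encode (a : Mem) : decode (encode a) = a := by
  have h : ∃ b, encode b = encode a := ⟨a, rfl⟩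
  rw [decode, dif_pos h]
  exact encode_injective h.choose_spec

-- No memory has an empty code, because `toNats` is never empty. The initial empty string therefore
-- decodes to `default`, whose value `k = 0` marks the first round.
@[simp] theorem decode_nil : decode [] = default := by
  rw [decode, dif_neg]
  rintro ⟨a, h⟩
  have : packWords (a.toNats.map Nat.bits) = packWords [] := by
    rw [show packWords [] = [] by simp [packWords]]; exact h
  simpa [toNats] using packWords_injective this

end Mem

/-- The decoded memory of an agent. -/
noncomputable def mem (s : AgentState) : Mem := Mem.decode s.mem

/-! ### The algorithm -/

/-- Distance of a patroller from the end of its segment in round `o` of a batch of ten rounds. -/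
def swing (o : ℕ) : ℕ := min (o - 1) (9 - o)

namespace Mem

def tick (a : Mem) : Mem := { a with t := a.t + 1 }

/-- The number of the current step of the walk. -/
def phase (a : Mem) : ℕ := a.t / 32

/-- The rank of the patroller that records the current step of the walk. -/
def lead (a : Mem) : ℕ := a.phase / 4

def offset (a : Mem) : ℕ := a.t % 32

/-- The port taken in round `o` of a batch by a patroller: four rounds back along its segment,
then four rounds forth. -/
def patrolPort (a : Mem) (o : ℕ) : ℕ :=
  if 1 ≤ o ∧ o ≤ 4 then (a.hist.getD (o - 1) default).inn
  else if 5 ≤ o ∧ o ≤ 8 then (a.hist.getD (8 - o) default).out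
  else 0

/-- The port towards the DFS parent of its current node, as far as a patroller knows it. -/
def parentHint (a : Mem) (o : ℕ) : ℕ :=
  if (a.hist.getD (swing o) default).idx = 0 then 0 else (a.hist.getD (swing o) default).inn

/-- The port to probe in batch `b` by the agent of rank `rk`, at a node of degree `deg`. -/
def probe (deg j rk b : ℕ) : ℕ :=
  if b = 0 then 0 else if 2 * (rk - j - 1) + b ≤ deg then 2 * (rk - j - 1) + b else 0

open Classical in
/-- A prober looks for patrollers at its current node. -/
noncomputable def observe (a : Mem) (here : Finset AgentState) (o : ℕ) : Mem :=
  { a with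
    saw := a.saw || decide (∃ s ∈ here, (mem s).rk ≤ a.lead)
    pp := if a.tgt = 0 then
        max a.pp (here.sup fun s => if (mem s).rk ≤ a.lead then (mem s).parentHint o else 0)
      else a.pp }

/-- A seeker in round `o` of batch `b`. -/
noncomputable def seek (a : Mem) (deg pin : ℕ) (here : Finset AgentState) (b o : ℕ) : Mem × ℕ :=
  if o = 0 then
    ({ a with
        tgt := probe deg a.lead a.rk b
        saw := false
        pp := if b = 0 then 0 else a.pp
        cand := if b = 0 then 0 else a.cand }, probe deg a.lead a.rk b)
  else if o = 9 then
    ({ a.observe here o with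
        cand := if (a.observe here o).saw = false ∧ a.tgt ≠ 0 then a.tgt else a.cand },
      if a.tgt = 0 then 0 else pin)
  else (a.observe here o, 0)

noncomputable def bestCand (j : ℕ) (here : Finset AgentState) : ℕ :=
  here.sup fun s => if j < (mem s).rk then (mem s).cand else 0

noncomputable def bestParent (j : ℕ) (here : Finset AgentState) : ℕ :=
  here.sup fun s => if j < (mem s).rk then (mem s).pp else 0

/-- The next step of the walk: to an undiscovered neighbour if one was found, else to the DFS
parent; no move once `k` nodes are discovered. -/
noncomputable def advance (a : Mem) (here : Finset AgentState) : Mem × ℕ :=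
  if a.x < a.k then
    if bestCand a.lead here ≠ 0 then
      ({ a with x := a.x + 1, nw := a.x }, bestCand a.lead here)
    else ({ a with nw := 0 }, bestParent a.lead here)
  else ({ a with nw := 0 }, 0)

/-- The leading patroller records the step just made. -/
def record (a : Mem) (pin pout : ℕ) : Mem :=
  { a with hist := (⟨pout, if pout = 0 then 0 else pin, a.nw⟩ :: a.hist).take 4 }

/-- Rounds 0 to 29 are three batches of ten and round 30 is the move. Recording waits for round 31,
since the incoming port is known only after the move. -/
noncomputable def grow (a : Mem) (deg pin pout : ℕ) (here : Finset AgentState) : Mem × ℕ :=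
  if a.offset < 30 then
    if a.rk ≤ a.lead then (a, a.patrolPort (a.offset % 10))
    else a.seek deg pin here (a.offset / 10) (a.offset % 10)
  else if a.offset = 30 then
    if a.rk < a.lead then (a, 0) else a.advance here
  else if a.rk = a.lead then (a.record pin pout, 0) else (a, 0)

/-- The number of steps of the walk that remain to be undone. -/
def left (a : Mem) : ℕ := 66 * a.k - a.t

/-- The rank of the patroller that has recorded the step of the walk to be undone. -/
def guide (a : Mem) : ℕ := (a.left - 1) / 4

/-- The recorded step of the walk that is to be undone. -/
def undo (a : Mem) : Entry :=
  a.hist.getD (min (2 * a.k) (4 * (a.guide + 1)) - a.left) default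

/-- Agents of rank below the guide wait at the ends of their segments until the group comes by. Rank
0 never settles on the way: its place is the start node, where the undone walk ends. Settling does
not tick the clock, as `st` takes precedence over it. -/
noncomputable def retreat (a : Mem) (here : Finset AgentState) : Mem × ℕ :=
  if a.rk < a.guide then (a.tick, 0)
  else if a.rk ≠ 0 ∧ (here.sup fun s => if (mem s).rk = a.guide then (mem s).undo.idx else 0) = a.rk
  then ({ a with st := true }, 0)
  else (a.tick, here.sup fun s => if (mem s).rk = a.guide then (mem s).undo.inn else 0)

end Mem

/-- The first round: the agents count and rank themselves. -/
noncomputable def start (self : AgentState) (here : Finset AgentState) : Mem :=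
  { (default : Mem) with
    k := here.card
    rk := (here.filter fun s => s.id < self.id).card
    x := 1 }

/-- The clock limits are `64 * k`, for `2 * k` steps of 32 rounds, and `66 * k`, for one further
round per step undone. -/
noncomputable def act (deg : ℕ) (self : AgentState) (here : Finset AgentState) : Mem × ℕ :=
  if (mem self).k = 0 then (start self here, 0)
  else if (mem self).st = true then (mem self, 0)
  else if (mem self).t < 64 * (mem self).k then
    (((mem self).grow deg self.pin self.pout here).1.tick,
      ((mem self).grow deg self.pin self.pout here).2)
  else if (mem self).t < 66 * (mem self).k then (mem self).retreat here
  else (mem self, 0)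

noncomputable def alg : SyncAlgorithm where
  compute deg self here := ((act deg self here).1.encode, (act deg self here).2)

/-! ### Port labelings -/

section Ports

variable {V : Type*} [Fintype V] {G : SimpleGraph V} [DecidableRel G.Adj] (p : PortLabeling G)

@[simp] theorem nbr_zero (v : V) : p.nbr v 0 = v := by simp [PortLabeling.nbr]

theorem adj_nbr {v : V} {i : ℕ} (h1 : i ≠ 0) (h2 : i ≤ G.degree v) : G.Adj v (p.nbr v i) := by
  have h : i ∈ Set.Icc 1 (G.degree v) := ⟨by omega, h2⟩
  rw [PortLabeling.nbr, dif_pos h]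
  exact ((p v).symm ⟨i, h⟩).2

theorem label_mem {v u : V} (h : G.Adj v u) : p.label v u ∈ Set.Icc 1 (G.degree v) := by
  rw [PortLabeling.label, dif_pos h]
  exact (p v ⟨u, h⟩).2

theorem nbr_label {v u : V} (h : G.Adj v u) : p.nbr v (p.label v u) = u := by
  rw [PortLabeling.nbr, dif_pos (label_mem p h)]
  have : (⟨p.label v u, label_mem p h⟩ : Set.Icc 1 (G.degree v)) = p v ⟨u, h⟩ := by
    ext; simp [PortLabeling.label, h]
  rw [this]; simp

theorem nbr_injOn (v : V) : Set.InjOn (p.nbr v) (Set.Icc 1 (G.degree v)) := by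
  intro i hi j hj h
  rw [PortLabeling.nbr, PortLabeling.nbr, dif_pos hi, dif_pos hj] at h
  simpa using (p v).symm.injective (Subtype.ext h)

theorem label_le_maxDegree (v u : V) : p.label v u ≤ G.maxDegree := by
  by_cases h : G.Adj v u
  · exact (label_mem p h).2.trans (G.degree_le_maxDegree v)
  · simp [PortLabeling.label, h]

end Ports

/-! ### The size of the memory -/

structure Entry.Bounded (K D : ℕ) (e : Entry) : Prop where
  out : e.out ≤ D
  inn : e.inn ≤ D
  idx : e.idx ≤ K

structure Mem.Bounded (K D : ℕ) (a : Mem) : Prop where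
  k : a.k ≤ K
  rk : a.rk ≤ K
  t : a.t ≤ 66 * a.k
  x : a.x ≤ K
  nw : a.nw ≤ K
  tgt : a.tgt ≤ D
  pp : a.pp ≤ D
  cand : a.cand ≤ D
  length : a.hist.length ≤ 4
  hist : ∀ e ∈ a.hist, e.Bounded K D

structure BoundedState (K D : ℕ) (s : AgentState) : Prop where
  pin : s.pin ≤ D
  pout : s.pout ≤ D
  mem : (mem s).Bounded K D

theorem Entry.bounded_default (K D : ℕ) : (default : Entry).Bounded K D :=
  ⟨Nat.zero_le _, Nat.zero_le _, Nat.zero_le _⟩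

theorem Mem.bounded_default (K D : ℕ) : (default : Mem).Bounded K D :=
  ⟨Nat.zero_le _, Nat.zero_le _, Nat.zero_le _, Nat.zero_le _, Nat.zero_le _, Nat.zero_le _,
    Nat.zero_le _, Nat.zero_le _, Nat.zero_le _, by simp [default]⟩

/-! ### Size bounds are preserved by a round. -/

section Bounds

variable {K D : ℕ} {a : Mem} {here : Finset AgentState}

theorem Mem.Bounded.getD (ha : a.Bounded K D) (d : ℕ) :
    (a.hist.getD d default).Bounded K D := by
  by_cases h : d < a.hist.length
  · rw [List.getD_eq_getElem _ _ h]; exact ha.hist _ (List.getElem_mem h)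
  · rw [List.getD_eq_default _ _ (by omega)]; exact Entry.bounded_default K D

theorem Mem.Bounded.patrolPort_le (ha : a.Bounded K D) (o : ℕ) : a.patrolPort o ≤ D := by
  unfold Mem.patrolPort
  split_ifs
  · exact (ha.getD _).inn
  · exact (ha.getD _).out
  · exact Nat.zero_le _

theorem Mem.Bounded.parentHint_le (ha : a.Bounded K D) (o : ℕ) : a.parentHint o ≤ D := by
  unfold Mem.parentHint
  split_ifs
  · exact Nat.zero_le _
  · exact (ha.getD _).inn

theorem Mem.probe_le (deg j rk b : ℕ) : Mem.probe deg j rk b ≤ deg := by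
  unfold Mem.probe
  split_ifs <;> omega

theorem Mem.Bounded.observe (ha : a.Bounded K D) (hh : ∀ s ∈ here, BoundedState K D s) (o : ℕ) :
    (a.observe here o).Bounded K D := by
  refine ⟨ha.k, ha.rk, ha.t, ha.x, ha.nw, ha.tgt, ?_, ha.cand, ha.length, ha.hist⟩
  simp only [Mem.observe]
  split_ifs
  · refine max_le ha.pp (Finset.sup_le fun s hs => ?_)
    split_ifs
    · exact (hh s hs).mem.parentHint_le o
    · exact Nat.zero_le _
  · exact ha.pp

theorem Mem.Bounded.seek (ha : a.Bounded K D) (hh : ∀ s ∈ here, BoundedState K D s)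
    {deg pin : ℕ} (hd : deg ≤ D) (hp : pin ≤ D) (b o : ℕ) :
    (a.seek deg pin here b o).1.Bounded K D ∧ (a.seek deg pin here b o).2 ≤ D := by
  have hpr := (Mem.probe_le deg a.lead a.rk b).trans hd
  unfold Mem.seek
  split_ifs with h1 h2 h3 h4 h5
  · exact ⟨⟨ha.k, ha.rk, ha.t, ha.x, ha.nw, hpr, Nat.zero_le _, Nat.zero_le _, ha.length,
      ha.hist⟩, hpr⟩
  · exact ⟨⟨ha.k, ha.rk, ha.t, ha.x, ha.nw, hpr, ha.pp, ha.cand, ha.length, ha.hist⟩, hpr⟩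
  · have ho := ha.observe hh o
    exact ⟨⟨ha.k, ha.rk, ha.t, ha.x, ha.nw, ha.tgt, ho.pp, ha.tgt, ha.length, ha.hist⟩,
      Nat.zero_le _⟩
  · have ho := ha.observe hh o
    exact ⟨⟨ha.k, ha.rk, ha.t, ha.x, ha.nw, ha.tgt, ho.pp, ha.tgt, ha.length, ha.hist⟩, hp⟩
  · have ho := ha.observe hh o
    exact ⟨⟨ha.k, ha.rk, ha.t, ha.x, ha.nw, ha.tgt, ho.pp, ha.cand, ha.length, ha.hist⟩,
      Nat.zero_le _⟩
  · have ho := ha.observe hh o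
    exact ⟨⟨ha.k, ha.rk, ha.t, ha.x, ha.nw, ha.tgt, ho.pp, ha.cand, ha.length, ha.hist⟩, hp⟩
  · exact ⟨ha.observe hh o, Nat.zero_le _⟩

theorem Mem.Bounded.advance (ha : a.Bounded K D) (hh : ∀ s ∈ here, BoundedState K D s) :
    (a.advance here).1.Bounded K D ∧ (a.advance here).2 ≤ D := by
  have hk := ha.k
  unfold Mem.advance
  split_ifs with h1 h2
  · refine ⟨⟨ha.k, ha.rk, ha.t, ?_, ha.x, ha.tgt, ha.pp, ha.cand, ha.length, ha.hist⟩, ?_⟩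
    · change a.x + 1 ≤ K
      omega
    · refine Finset.sup_le fun s hs => ?_
      split_ifs
      · exact (hh s hs).mem.cand
      · exact Nat.zero_le _
  · refine ⟨⟨ha.k, ha.rk, ha.t, ha.x, Nat.zero_le _, ha.tgt, ha.pp, ha.cand, ha.length,
      ha.hist⟩, ?_⟩
    refine Finset.sup_le fun s hs => ?_
    split_ifs
    · exact (hh s hs).mem.pp
    · exact Nat.zero_le _
  · exact ⟨⟨ha.k, ha.rk, ha.t, ha.x, Nat.zero_le _, ha.tgt, ha.pp, ha.cand, ha.length,
      ha.hist⟩, Nat.zero_le _⟩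

theorem Mem.Bounded.record (ha : a.Bounded K D) {pin pout : ℕ} (hi : pin ≤ D) (ho : pout ≤ D) :
    (a.record pin pout).Bounded K D := by
  refine ⟨ha.k, ha.rk, ha.t, ha.x, ha.nw, ha.tgt, ha.pp, ha.cand, by simp [Mem.record], ?_⟩
  intro e he
  rcases List.mem_cons.mp (List.mem_of_mem_take he) with rfl | he
  · refine ⟨ho, ?_, ha.nw⟩
    dsimp only
    split_ifs
    · exact Nat.zero_le _
    · exact hi
  · exact ha.hist e he

theorem Mem.Bounded.tick (ha : a.Bounded K D) (ht : a.t < 66 * a.k) : a.tick.Bounded K D :=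
  ⟨ha.k, ha.rk, ht, ha.x, ha.nw, ha.tgt, ha.pp, ha.cand, ha.length, ha.hist⟩

theorem Mem.Bounded.grow (ha : a.Bounded K D) (hh : ∀ s ∈ here, BoundedState K D s)
    {deg pin pout : ℕ} (hd : deg ≤ D) (hi : pin ≤ D) (ho : pout ≤ D) :
    (a.grow deg pin pout here).1.Bounded K D ∧ (a.grow deg pin pout here).2 ≤ D := by
  unfold Mem.grow
  split_ifs
  · exact ⟨ha, ha.patrolPort_le _⟩
  · exact ha.seek hh hd hi _ _
  · exact ⟨ha, Nat.zero_le _⟩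
  · exact ha.advance hh
  · exact ⟨ha.record hi ho, Nat.zero_le _⟩
  · exact ⟨ha, Nat.zero_le _⟩

@[simp] theorem Mem.seek_k (a : Mem) (deg pin : ℕ) (b o : ℕ) :
    (a.seek deg pin here b o).1.k = a.k := by
  unfold Mem.seek; split_ifs <;> rfl

@[simp] theorem Mem.seek_t (a : Mem) (deg pin : ℕ) (b o : ℕ) :
    (a.seek deg pin here b o).1.t = a.t := by
  unfold Mem.seek; split_ifs <;> rfl

theorem Mem.grow_k_t (a : Mem) (deg pin pout : ℕ) :
    (a.grow deg pin pout here).1.k = a.k ∧ (a.grow deg pin pout here).1.t = a.t := by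
  unfold Mem.grow
  split_ifs
  · exact ⟨rfl, rfl⟩
  · simp
  · exact ⟨rfl, rfl⟩
  · unfold Mem.advance; split_ifs <;> exact ⟨rfl, rfl⟩
  · exact ⟨rfl, rfl⟩
  · exact ⟨rfl, rfl⟩

theorem Mem.Bounded.retreat (ha : a.Bounded K D) (hh : ∀ s ∈ here, BoundedState K D s)
    (ht : a.t < 66 * a.k) :
    (a.retreat here).1.Bounded K D ∧ (a.retreat here).2 ≤ D := by
  unfold Mem.retreat
  split_ifs
  · exact ⟨ha.tick ht, Nat.zero_le _⟩
  · exact ⟨⟨ha.k, ha.rk, ha.t, ha.x, ha.nw, ha.tgt, ha.pp, ha.cand, ha.length, ha.hist⟩,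
      Nat.zero_le _⟩
  · refine ⟨ha.tick ht, Finset.sup_le fun s hs => ?_⟩
    split_ifs
    · exact ((hh s hs).mem.getD _).inn
    · exact Nat.zero_le _

theorem bounded_act {s : AgentState} (hs : s ∈ here) (hh : ∀ s ∈ here, BoundedState K D s)
    (hc : here.card ≤ K) {deg : ℕ} (hd : deg ≤ D) :
    (act deg s here).1.Bounded K D ∧ (act deg s here).2 ≤ D := by
  have ha := (hh s hs).mem
  unfold act
  split_ifs with h1 h2 h3 h4
  · refine ⟨⟨hc, (Finset.card_filter_le _ _).trans hc, Nat.zero_le _, ?_, Nat.zero_le _,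
      Nat.zero_le _, Nat.zero_le _, Nat.zero_le _, Nat.zero_le _, by simp [start, default]⟩,
      Nat.zero_le _⟩
    exact (Finset.card_pos.mpr ⟨s, hs⟩).trans_le hc
  · exact ⟨ha, Nat.zero_le _⟩
  · have hg := ha.grow hh hd (hh s hs).pin (hh s hs).pout
    have hkt := Mem.grow_k_t (here := here) (mem s) deg s.pin s.pout
    refine ⟨hg.1.tick ?_, hg.2⟩
    omega
  · exact ha.retreat hh h4
  · exact ⟨ha, Nat.zero_le _⟩

end Bounds

/-! ### The bit bound along a run. -/

section Memory

variable {V : Type*} [Fintype V] [DecidableEq V] {G : SimpleGraph V} [DecidableRel G.Adj] {k : ℕ}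

/-- The last clause is needed because a bound on the decoded memory says nothing about the length of
a string that is not a code. -/
theorem bounded_run (p : PortLabeling G) (s : V) (ID : Fin k → ℕ) (t : ℕ) (i : Fin k) :
    BoundedState k G.maxDegree ((alg.run p (Config.rooted s ID) t).state i) ∧
      ((alg.run p (Config.rooted s ID) t).state i).id = ID i ∧
      ∃ a : Mem, ((alg.run p (Config.rooted s ID) t).state i).mem = [] ∨
        ((alg.run p (Config.rooted s ID) t).state i).mem = a.encode := by
  induction t generalizing i with
  | zero =>
    refine ⟨⟨Nat.zero_le _, Nat.zero_le _, ?_⟩, rfl, default, Or.inl rfl⟩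
    simpa [SyncAlgorithm.run, Config.rooted, mem] using Mem.bounded_default _ _
  | succ t ih =>
    rw [SyncAlgorithm.run, Function.iterate_succ_apply', ← SyncAlgorithm.run]
    set c := alg.run p (Config.rooted s ID) t
    have hh : ∀ a ∈ c.view i, BoundedState k G.maxDegree a := by
      intro a ha
      obtain ⟨j, -, rfl⟩ := Finset.mem_image.mp ha
      exact (ih j).1
    have hs : c.state i ∈ c.view i := Finset.mem_image.mpr ⟨i, by simp, rfl⟩
    have hc : (c.view i).card ≤ k :=
      Finset.card_image_le.trans ((Finset.card_filter_le _ _).trans (by simp))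
    obtain ⟨h1, h2⟩ := bounded_act hs hh hc (G.degree_le_maxDegree (c.pos i))
    refine ⟨⟨?_, h2, ?_⟩, (ih i).2.1, _, Or.inr rfl⟩
    · simp only [SyncAlgorithm.step]
      split_ifs
      · exact (ih i).1.pin
      · exact label_le_maxDegree p _ _
    · simpa [SyncAlgorithm.step, mem, alg] using h1

/-- There are ten scalar variables and at most four entries of three numbers each, 22 numbers in
all. -/
theorem Mem.Bounded.length_encode_le {K D N : ℕ} {a : Mem} (ha : a.Bounded K D)
    (hK : 66 * K ≤ N) (hD : D ≤ N) (h1 : 1 ≤ N) :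
    a.encode.length ≤ 22 * (2 * N.size + 1) := by
  refine (length_packNats_le _ N ?_).trans (Nat.mul_le_mul_right _ ?_)
  · intro n hn
    have := ha.k; have := ha.rk; have := ha.t; have := ha.x; have := ha.nw; have := ha.tgt
    have := ha.pp; have := ha.cand; have := a.saw.toNat_le; have := a.st.toNat_le
    simp only [Mem.toNats, List.cons_append, List.nil_append, List.mem_cons] at hn
    rcases hn with h | h | h | h | h | h | h | h | h | h | h
    all_goals first | omega | skip
    simp only [Mem.histNats, List.mem_flatMap, List.mem_cons, List.not_mem_nil, or_false] at h
    obtain ⟨e, he, h⟩ := h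
    have := (ha.hist e he).out; have := (ha.hist e he).inn; have := (ha.hist e he).idx
    omega
  · have : ∀ l : List Entry, (Mem.histNats l).length = 3 * l.length := by
      intro l
      induction l with
      | nil => rfl
      | cons e l ih => simp only [Mem.histNats, List.flatMap_cons, List.length_append,
          List.length_cons, List.length_nil] at ih ⊢; omega
    have := this a.hist
    have := ha.length
    simp only [Mem.toNats, List.length_append, List.length_cons, List.length_nil]
    omega

theorem usesMemory (c : ℕ) (p : PortLabeling G) (s : V) (ID : Fin k → ℕ)
    (hID : ∀ i, ID i ∈ Set.Icc 1 (k ^ c)) :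
    alg.UsesMemory p (Config.rooted s ID)
      ((c + 500) * (Nat.log 2 (k + G.maxDegree) + 1)) := by
  intro t i
  obtain ⟨hb, hid, a, ha⟩ := bounded_run p s ID t i
  set st := (alg.run p (Config.rooted s ID) t).state i
  set l := Nat.log 2 (k + G.maxDegree) with hl
  have hk : 0 < k := i.pos
  have hlt : k + G.maxDegree < 2 ^ (l + 1) := Nat.lt_pow_succ_log_self (by norm_num) _
  have h1 : st.id.size ≤ c * (l + 1) + 1 := by
    rw [Nat.size_le, hid]
    calc ID i ≤ k ^ c := (hID i).2
      _ ≤ (2 ^ (l + 1)) ^ c := Nat.pow_le_pow_left (by omega) c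
      _ = 2 ^ (c * (l + 1)) := by rw [← pow_mul, mul_comm]
      _ < _ := Nat.pow_lt_pow_right (by norm_num) (by omega)
  have h2 : st.pin.size ≤ l + 1 := Nat.size_le.mpr (by have := hb.pin; omega)
  have h3 : st.pout.size ≤ l + 1 := Nat.size_le.mpr (by have := hb.pout; omega)
  have h4 : st.mem.length ≤ 22 * (2 * (l + 8) + 1) := by
    rcases ha with ha | ha
    · simp [ha]
    · have hm : mem st = a := by simp [mem, ha]
      have hlen := (hm ▸ hb.mem).length_encode_le (N := 66 * (k + G.maxDegree)) (by omega)
        (by omega) (by omega)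
      -- The clock, at most `66 * k`, is the largest variable; 66 is below `2 ^ 7`.
      have hsz : (66 * (k + G.maxDegree)).size ≤ l + 8 := by
        rw [Nat.size_le, show l + 8 = (l + 1) + 7 by omega, pow_add]
        omega
      rw [ha]
      omega
  unfold AgentState.bits
  rw [add_mul]
  omega

end Memory

/-! ### Depth-first walks -/

section Visited

variable {V : Type*} (w : ℕ → V) (ent : ℕ → Entry)

/-- The node `u` is visited in the first `m` steps. -/
def Visited (m : ℕ) (u : V) : Prop := ∃ q ≤ m, w q = u

/-- The DFS parent of `a` is `b`. -/
def IsParent (m : ℕ) (a b : V) : Prop := ∃ q < m, (ent (q + 1)).idx ≠ 0 ∧ w (q + 1) = a ∧ w q = b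

variable {w ent}

theorem Visited.mono {m m' : ℕ} (h : m ≤ m') {u : V} (hu : Visited w m u) : Visited w m' u := by
  obtain ⟨q, hq, rfl⟩ := hu
  exact ⟨q, hq.trans h, rfl⟩

theorem visited_succ {m : ℕ} {u : V} : Visited w (m + 1) u ↔ Visited w m u ∨ u = w (m + 1) := by
  constructor
  · rintro ⟨q, hq, rfl⟩
    rcases Nat.lt_or_ge q (m + 1) with h | h
    · exact Or.inl ⟨q, by omega, rfl⟩
    · exact Or.inr (by rw [show q = m + 1 by omega])
  · rintro (h | rfl)
    · exact h.mono (by omega)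
    · exact ⟨m + 1, le_rfl, rfl⟩

theorem visited_iff_mem [DecidableEq V] {m : ℕ} {u : V} :
    Visited w m u ↔ u ∈ (Finset.range (m + 1)).image w := by
  simp [Visited]

theorem IsParent.mono {m m' : ℕ} (h : m ≤ m') {a b : V} (hu : IsParent w ent m a b) :
    IsParent w ent m' a b := by
  obtain ⟨q, hq, h'⟩ := hu
  exact ⟨q, by omega, h'⟩

end Visited

/-! ### Depth-first walks, independently of the algorithm. -/

section Walk

variable {V : Type*} [Fintype V] [DecidableEq V] {G : SimpleGraph V} [DecidableRel G.Adj]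
  (p : PortLabeling G) (k : ℕ) (w : ℕ → V) (ent : ℕ → Entry) (X : ℕ → ℕ)

/-- Step `m + 1` of a walk that explores a graph depth first until `k` nodes are visited. -/
structure IsDFSStep (m : ℕ) : Prop where
  forth : w (m + 1) = p.nbr (w m) (ent (m + 1)).out
  back : w m = p.nbr (w (m + 1)) (ent (m + 1)).inn
  cases : (X m < k ∧ ¬ Visited w m (w (m + 1)) ∧ (ent (m + 1)).idx = X m ∧ X (m + 1) = X m + 1 ∧
      (ent (m + 1)).inn ≠ 0 ∧ (ent (m + 1)).inn ≤ G.degree (w (m + 1))) ∨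
    (X m < k ∧ (∀ u, G.Adj (w m) u → Visited w m u) ∧ (ent (m + 1)).idx = 0 ∧ X (m + 1) = X m ∧
      ∀ q < m, (ent (q + 1)).idx ≠ 0 → w (q + 1) = w m → w (m + 1) = w q) ∨
    (X m = k ∧ w (m + 1) = w m ∧ (ent (m + 1)).idx = 0 ∧ X (m + 1) = X m)

/-- The first `m` steps of a walk that explores a graph depth first until `k` nodes are visited;
`X` counts the visited nodes. -/
structure IsDFSWalk (m : ℕ) : Prop where
  forth : ∀ q < m, w (q + 1) = p.nbr (w q) (ent (q + 1)).out
  back : ∀ q < m, w q = p.nbr (w (q + 1)) (ent (q + 1)).inn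
  fresh : ∀ q < m, (ent (q + 1)).idx ≠ 0 → (ent (q + 1)).idx = X q ∧ X (q + 1) = X q + 1 ∧
    ¬ Visited w q (w (q + 1)) ∧ (ent (q + 1)).inn ≠ 0 ∧
    (ent (q + 1)).inn ≤ G.degree (w (q + 1)) ∧ q + 2 ≤ 2 * X q
  stale : ∀ q < m, (ent (q + 1)).idx = 0 → X (q + 1) = X q
  card : ((Finset.range (m + 1)).image w).card = X m
  le : X m ≤ k
  stack : X m < k → ∃ l : List V, (w m :: l).IsChain (IsParent w ent m) ∧
    (∀ u, Visited w m u → u ∉ w m :: l → ∀ u', G.Adj u u' → Visited w m u') ∧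
    l.length + m + 2 = 2 * X m

variable {p k w ent X}

theorem isDFSWalk_zero (hk : 1 ≤ k) (hX : X 0 = 1) : IsDFSWalk p k w ent X 0 where
  forth := by simp
  back := by simp
  fresh := by simp
  stale := by simp
  card := by simp [hX]
  le := by omega
  stack _ := by
    refine ⟨[], List.isChain_singleton _, ?_, by simp [hX]⟩
    rintro u ⟨q, hq, rfl⟩ hu
    simp [Nat.le_zero.mp hq] at hu

theorem IsDFSWalk.one_le {m : ℕ} (h : IsDFSWalk p k w ent X m) : 1 ≤ X m := by
  rw [← h.card, Nat.one_le_iff_ne_zero, Finset.card_ne_zero]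
  exact ⟨w 0, Finset.mem_image_of_mem _ (by simp)⟩

/-- A set of visited nodes that is closed under adjacency is everything. -/
theorem IsDFSWalk.not_closed {m : ℕ} (h : IsDFSWalk p k w ent X m) (hG : G.Connected)
    (hk : k ≤ Fintype.card V) (hx : X m < k) :
    ¬ ∀ u, Visited w m u → ∀ u', G.Adj u u' → Visited w m u' := by
  intro hc
  have hall : ∀ u, Visited w m u := by
    intro u
    obtain ⟨W⟩ := hG.preconnected (w 0) u
    have : ∀ {a b : V} (_ : G.Walk a b), Visited w m a → Visited w m b := by
      intro a b W
      induction W with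
      | nil => exact id
      | cons hadj _ ih => exact fun ha => ih (hc _ ha _ hadj)
    exact this W ⟨0, by omega, rfl⟩
  have : (Finset.range (m + 1)).image w = Finset.univ := by
    ext u; simpa using visited_iff_mem.mp (hall u)
  have hcard := h.card
  rw [this, Finset.card_univ] at hcard
  omega

/-- A discovery pushes the new node onto the stack and a return pops one; either change preserves
`l.length + m + 2 = 2 * X m`. Since the length is nonnegative, a discovery also gets the inequality
`q + 2 ≤ 2 * X q` of `fresh`, which the retreat relies on. -/
theorem IsDFSWalk.succ {m : ℕ} (h : IsDFSWalk p k w ent X m) (hs : IsDFSStep p k w ent X m)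
    (hG : G.Connected) (hk : k ≤ Fintype.card V) : IsDFSWalk p k w ent X (m + 1) := by
  have h1 := h.one_le
  have hcard := h.card
  have himg : (Finset.range (m + 1 + 1)).image w =
      insert (w (m + 1)) ((Finset.range (m + 1)).image w) := by
    rw [Finset.range_add_one, Finset.image_insert]
  have split : ∀ {Q : ℕ → Prop}, (∀ q < m, Q q) → Q m → ∀ q < m + 1, Q q := by
    intro Q hQ hm q hq
    rcases Nat.lt_succ_iff_lt_or_eq.mp hq with h | rfl
    exacts [hQ q h, hm]
  have forth := split h.forth hs.forth
  have back := split h.back hs.back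
  rcases hs.cases with ⟨hx, hnv, hidx, hX, hin, hin'⟩ | ⟨hx, hnb, hidx, hX, hpar⟩ |
    ⟨hx, hw, hidx, hX⟩
  · obtain ⟨l, hl1, hl2, hl3⟩ := h.stack hx
    refine ⟨forth, back, split h.fresh fun _ => ⟨hidx, hX, hnv, hin, hin', by omega⟩,
      split h.stale fun h0 => by omega, ?_, by omega, fun _ => ?_⟩
    · rw [himg, Finset.card_insert_of_notMem (by rwa [← visited_iff_mem]), hcard, hX]
    · refine ⟨w m :: l, ?_, ?_, by simp only [List.length_cons]; omega⟩
      · refine List.isChain_cons_cons.mpr ⟨⟨m, by omega, by omega, rfl, rfl⟩, ?_⟩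
        exact hl1.imp fun _ _ hab => hab.mono (by omega)
      · intro u hu hnu u' hadj
        rcases visited_succ.mp hu with hu | rfl
        · exact (hl2 u hu (fun h => hnu (List.mem_cons_of_mem _ h)) u' hadj).mono (by omega)
        · simp at hnu
  · obtain ⟨l, hl1, hl2, hl3⟩ := h.stack hx
    cases l with
    | nil =>
      -- With nothing below the current node on the stack and no unvisited neighbour left, the
      -- visited set is closed under adjacency, which connectivity forbids while fewer than `k`
      -- nodes are visited.
      refine absurd (fun u hu u' hadj => ?_) (h.not_closed hG hk hx)
      by_cases hum : u = w m
      · subst hum; exact hnb _ hadj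
      · exact hl2 u hu (by simpa using hum) u' hadj
    | cons b l =>
      obtain ⟨⟨q, hq, hq0, hqm, rfl⟩, hl1⟩ := List.isChain_cons_cons.mp hl1
      have hw := hpar q hq hq0 hqm
      have hv : Visited w m (w (m + 1)) := ⟨q, by omega, hw.symm⟩
      refine ⟨forth, back, split h.fresh fun h0 => absurd hidx h0, split h.stale fun _ => hX,
        ?_, by omega, fun _ => ⟨l, ?_, ?_, by simp only [List.length_cons] at hl3; omega⟩⟩
      · rw [himg, Finset.insert_eq_of_mem (by rwa [← visited_iff_mem]), hcard, hX]
      · rw [hw]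
        exact hl1.imp fun _ _ hab => hab.mono (by omega)
      · intro u hu hnu u' hadj
        have hu : Visited w m u := by
          rcases visited_succ.mp hu with hu | rfl
          exacts [hu, hv]
        refine Visited.mono (Nat.le_succ m) ?_
        by_cases hum : u = w m
        · subst hum; exact hnb _ hadj
        · refine hl2 u hu ?_ u' hadj
          rw [hw] at hnu
          simp only [List.mem_cons, not_or] at hnu ⊢
          exact ⟨hum, hnu⟩
  · have hv : Visited w m (w (m + 1)) := ⟨m, le_rfl, hw.symm⟩
    refine ⟨forth, back, split h.fresh fun h0 => absurd hidx h0, split h.stale fun _ => hX,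
      ?_, by omega, fun _ => by omega⟩
    rw [himg, Finset.insert_eq_of_mem (by rwa [← visited_iff_mem]), hcard, hX]

/-- If fewer than `k` nodes were visited, the stack equation would give `2 * k + 2 ≤ 2 * X (2 * k) <
2 * k`. -/
theorem IsDFSWalk.complete (h : IsDFSWalk p k w ent X (2 * k)) : X (2 * k) = k := by
  by_contra hne
  have := h.le
  obtain ⟨l, -, -, hl⟩ := h.stack (by omega)
  omega

theorem IsDFSWalk.exists_idx {m : ℕ} (h : IsDFSWalk p k w ent X m) (h0 : X 0 = 1) {r : ℕ}
    (hr : 1 ≤ r) (hrX : r < X m) : ∃ q < m, (ent (q + 1)).idx = r := by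
  have key : ∀ n ≤ m, r < X n → ∃ q < n, (ent (q + 1)).idx = r := by
    intro n
    induction n with
    | zero => intro _ h; omega
    | succ n ih =>
      intro hn hrn
      by_cases hlt : r < X n
      · obtain ⟨q, hq, hqr⟩ := ih (by omega) hlt
        exact ⟨q, by omega, hqr⟩
      · by_cases hi : (ent (n + 1)).idx = 0
        · have := h.stale n (by omega) hi
          omega
        · obtain ⟨h1, h2, -⟩ := h.fresh n (by omega) hi
          exact ⟨n, by omega, by omega⟩
  exact key m le_rfl hrX

/-- A node with an unvisited neighbour has one behind one of its first `k - 1` ports. -/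
theorem IsDFSWalk.exists_port {m : ℕ} (h : IsDFSWalk p k w ent X m) (hx : X m < k) {u : V}
    (hadj : G.Adj (w m) u) (hu : ¬ Visited w m u) :
    ∃ i, 1 ≤ i ∧ i ≤ G.degree (w m) ∧ i ≤ k - 1 ∧ ¬ Visited w m (p.nbr (w m) i) := by
  have hl := label_mem p hadj
  by_cases hd : p.label (w m) u ≤ k - 1
  · exact ⟨_, hl.1, hl.2, hd, by rwa [nbr_label p hadj]⟩
  · by_contra hcon
    push Not at hcon
    have hdeg : k - 1 ≤ G.degree (w m) := by have := hl.2; omega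
    -- Otherwise the first `k - 1` ports lead to `k - 1` distinct visited nodes other than `w m`,
    -- but there are only `X m - 1 ≤ k - 2` of these.
    have hsub : (Finset.Icc 1 (k - 1)).image (p.nbr (w m)) ⊆
        ((Finset.range (m + 1)).image w).erase (w m) := by
      intro v hv
      obtain ⟨i, hi, rfl⟩ := Finset.mem_image.mp hv
      rw [Finset.mem_Icc] at hi
      have hne := (adj_nbr p (v := w m) (i := i) (by omega) (by omega)).ne'
      exact Finset.mem_erase.mpr ⟨hne, visited_iff_mem.mp (hcon i hi.1 (by omega) hi.2)⟩
    have hle := Finset.card_le_card hsub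
    rw [Finset.card_image_of_injOn, Finset.card_erase_of_mem, h.card, Nat.card_Icc] at hle
    · have := h.one_le
      omega
    · exact visited_iff_mem.mp ⟨m, le_rfl, rfl⟩
    · intro i hi j hj hij
      simp only [Finset.coe_Icc, Set.mem_Icc] at hi hj
      exact nbr_injOn p (w m) ⟨hi.1, by omega⟩ ⟨hj.1, by omega⟩ hij

end Walk

/-! ### The run of the algorithm -/

theorem mem_view {V : Type*} [DecidableEq V] {k : ℕ} {c : Config V k} {i : Fin k} {a : AgentState} :
    a ∈ c.view i ↔ ∃ j, c.pos j = c.pos i ∧ c.state j = a := by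
  simp [Config.view]

section Run

variable {V : Type*} [Fintype V] [DecidableEq V] {G : SimpleGraph V} [DecidableRel G.Adj] {k : ℕ}

/-- The configurations `c 0, c 1, …` of a run of the algorithm from the end of its first round on,
where `rank` is the ranking of the agents and `z` the last agent in this ranking. -/
structure IsRun (p : PortLabeling G) (c : ℕ → Config V k) (rank : Fin k → ℕ) (z : Fin k)
    (s : V) : Prop where
  step : ∀ t, c (t + 1) = alg.step p (c t)
  inj : Function.Injective rank
  lt : ∀ i, rank i < k
  last : rank z = k - 1
  pos_zero : ∀ i, (c 0).pos i = s
  mem_zero : ∀ i, mem ((c 0).state i) = { (default : Mem) with k := k, rk := rank i, x := 1 }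

variable {p : PortLabeling G} {c : ℕ → Config V k} {rank : Fin k → ℕ} {z : Fin k} {s : V}

namespace IsRun

theorem pos_k (h : IsRun p c rank z s) : 0 < k := (Nat.zero_le _).trans_lt (h.lt z)

theorem exists_rank (h : IsRun p c rank z s) {r : ℕ} (hr : r < k) : ∃ i, rank i = r := by
  let f : Fin k → Fin k := fun i => ⟨rank i, h.lt i⟩
  have hf : Function.Injective f := fun a b hab => h.inj (by simpa [f] using hab)
  obtain ⟨i, hi⟩ := (Finite.injective_iff_surjective.mp hf) ⟨r, hr⟩
  exact ⟨i, by simpa [f] using hi⟩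

theorem pos_succ (h : IsRun p c rank z s) (t : ℕ) (i : Fin k) :
    (c (t + 1)).pos i = p.nbr ((c t).pos i)
      (act (G.degree ((c t).pos i)) ((c t).state i) ((c t).view i)).2 := by
  rw [h.step]; rfl

theorem mem_succ (h : IsRun p c rank z s) (t : ℕ) (i : Fin k) :
    mem ((c (t + 1)).state i) =
      (act (G.degree ((c t).pos i)) ((c t).state i) ((c t).view i)).1 := by
  rw [h.step]; simp [SyncAlgorithm.step, mem, alg]

theorem pout_succ (h : IsRun p c rank z s) (t : ℕ) (i : Fin k) :
    ((c (t + 1)).state i).pout =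
      (act (G.degree ((c t).pos i)) ((c t).state i) ((c t).view i)).2 := by
  rw [h.step]; rfl

theorem pin_succ (h : IsRun p c rank z s) (t : ℕ) (i : Fin k) :
    ((c (t + 1)).state i).pin = if (c (t + 1)).pos i = (c t).pos i then ((c t).state i).pin
      else p.label ((c (t + 1)).pos i) ((c t).pos i) := by
  rw [h.step]; rfl

end IsRun

theorem Mem.grow_rk_st (a : Mem) (deg pin pout : ℕ) (here : Finset AgentState) :
    (a.grow deg pin pout here).1.rk = a.rk ∧ (a.grow deg pin pout here).1.st = a.st := by
  unfold Mem.grow Mem.advance Mem.seek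
  split_ifs <;> exact ⟨rfl, rfl⟩

theorem Mem.grow_hist {a : Mem} (h : a.offset = 31 → a.rk ≠ a.lead) (deg pin pout : ℕ)
    (here : Finset AgentState) :
    (a.grow deg pin pout here).1.hist = a.hist := by
  have : a.offset < 32 := Nat.mod_lt _ (by norm_num)
  unfold Mem.grow Mem.advance Mem.seek
  split_ifs <;> first | rfl | exact absurd ‹a.rk = a.lead› (h (by omega))

theorem Mem.grow_x {a : Mem} (h : a.offset ≠ 30) (deg pin pout : ℕ) (here : Finset AgentState) :
    (a.grow deg pin pout here).1.x = a.x := by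
  unfold Mem.grow Mem.seek
  split_ifs <;> rfl

/-- What every agent knows at time `t` of the growth of the tree. -/
structure Basic (k : ℕ) (c : ℕ → Config V k) (rank : Fin k → ℕ) (t : ℕ) (i : Fin k) : Prop where
  k : (mem ((c t).state i)).k = k
  rk : (mem ((c t).state i)).rk = rank i
  st : (mem ((c t).state i)).st = false
  t : (mem ((c t).state i)).t = t

namespace IsRun

theorem act_eq (h : IsRun p c rank z s) {t : ℕ} (ht : t < 64 * k) {i : Fin k}
    (hb : Basic k c rank t i) (deg : ℕ) (here : Finset AgentState) :
    act deg ((c t).state i) here =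
      (((mem ((c t).state i)).grow deg ((c t).state i).pin ((c t).state i).pout here).1.tick,
        ((mem ((c t).state i)).grow deg ((c t).state i).pin ((c t).state i).pout here).2) := by
  have hk := h.pos_k
  rw [act, if_neg (by rw [hb.k]; omega), if_neg (by rw [hb.st]; decide),
    if_pos (by rw [hb.k, hb.t]; omega)]

theorem basic (h : IsRun p c rank z s) {t : ℕ} (ht : t ≤ 64 * k) (i : Fin k) :
    Basic k c rank t i := by
  induction t with
  | zero => constructor <;> simp [h.mem_zero, default]
  | succ t ih =>
    have hb := ih (by omega)
    have hm := h.mem_succ t i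
    rw [h.act_eq (by omega) hb] at hm
    constructor
    · rw [hm]; exact (Mem.grow_k_t _ _ _ _).1.trans hb.k
    · rw [hm]; exact (Mem.grow_rk_st _ _ _ _ _).1.trans hb.rk
    · rw [hm]; exact (Mem.grow_rk_st _ _ _ _ _).2.trans hb.st
    · rw [hm]; exact congrArg (· + 1) ((Mem.grow_k_t _ _ _ _).2.trans hb.t)

theorem lead_offset (h : IsRun p c rank z s) {m τ : ℕ} (hm : m < 2 * k) (hτ : τ < 32)
    (i : Fin k) :
    (mem ((c (32 * m + τ)).state i)).lead = m / 4 ∧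
      (mem ((c (32 * m + τ)).state i)).offset = τ := by
  have hb := h.basic (t := 32 * m + τ) (by omega) i
  rw [Mem.lead, Mem.phase, Mem.offset, hb.t]
  omega

/-- The result of one round during the growth of the tree. -/
theorem grow_succ (h : IsRun p c rank z s) {m τ : ℕ} (hm : m < 2 * k) (hτ : τ < 32) (i : Fin k)
    {r : Mem × ℕ} (hr : (mem ((c (32 * m + τ)).state i)).grow (G.degree ((c (32 * m + τ)).pos i))
      ((c (32 * m + τ)).state i).pin ((c (32 * m + τ)).state i).pout ((c (32 * m + τ)).view i)
      = r) :
    mem ((c (32 * m + τ + 1)).state i) = r.1.tick ∧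
      (c (32 * m + τ + 1)).pos i = p.nbr ((c (32 * m + τ)).pos i) r.2 ∧
      ((c (32 * m + τ + 1)).state i).pout = r.2 := by
  have hb := h.basic (t := 32 * m + τ) (by omega) i
  rw [h.mem_succ, h.pos_succ, h.pout_succ, h.act_eq (by omega) hb, hr]
  exact ⟨rfl, rfl, rfl⟩

/-- An agent that moves through a port can return through its incoming port. -/
theorem pin_of_move (h : IsRun p c rank z s) {t : ℕ} {i : Fin k} {v : V} {q : ℕ}
    (hv : (c t).pos i = v) (hq : (c (t + 1)).pos i = p.nbr v q) (h0 : q ≠ 0)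
    (hd : q ≤ G.degree v) :
    p.nbr (p.nbr v q) ((c (t + 1)).state i).pin = v ∧ ((c (t + 1)).state i).pin ≠ 0 ∧
      ((c (t + 1)).state i).pin ≤ G.degree (p.nbr v q) ∧
      ((c (t + 1)).state i).pin = p.label (p.nbr v q) v := by
  have hadj := adj_nbr p h0 hd
  have hl := label_mem p hadj.symm
  rw [h.pin_succ, hq, hv, if_neg hadj.ne']
  exact ⟨nbr_label p hadj.symm, Nat.one_le_iff_ne_zero.mp hl.1, hl.2, rfl⟩

end IsRun

/-! ### The walk of the group -/

/-- The node where the group is before step `m` of the walk. -/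
def walk (c : ℕ → Config V k) (z : Fin k) (m : ℕ) : V := (c (32 * m)).pos z

/-- The record of step `m ≥ 1` of the walk. -/
noncomputable def entry (c : ℕ → Config V k) (z : Fin k) (m : ℕ) : Entry :=
  ⟨((c (32 * m - 1)).state z).pout,
    if ((c (32 * m - 1)).state z).pout = 0 then 0 else ((c (32 * m - 1)).state z).pin,
    (mem ((c (32 * m - 1)).state z)).nw⟩

/-- The number of nodes discovered before step `m` of the walk. -/
noncomputable def count (c : ℕ → Config V k) (z : Fin k) (m : ℕ) : ℕ :=
  (mem ((c (32 * m)).state z)).x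

/-- The last step before time `m` in the segment of the patroller of rank `r`. -/
def segEnd (r m : ℕ) : ℕ := min m (4 * (r + 1))

/-- What the patroller of rank `r` has recorded after `m` steps of the walk. -/
def segment (ent : ℕ → Entry) (r m : ℕ) : List Entry :=
  (List.range (segEnd r m - 4 * r)).map fun d => ent (segEnd r m - d)

theorem segment_getD {ent : ℕ → Entry} {r m d : ℕ} (hd : d < segEnd r m - 4 * r) :
    (segment ent r m).getD d default = ent (segEnd r m - d) := by
  rw [List.getD_eq_getElem _ _ (by simpa [segment] using hd)]
  simp [segment]

theorem segment_getD_of_le {ent : ℕ → Entry} {r m d : ℕ} (hd : segEnd r m - 4 * r ≤ d) :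
    (segment ent r m).getD d default = default :=
  List.getD_eq_default _ _ (by simpa [segment] using hd)

/-- The leader holds at most three entries before this step, so `take 4` drops nothing. -/
theorem segment_succ_lead {ent : ℕ → Entry} {r m : ℕ} (h : r = m / 4) :
    segment ent r (m + 1) = (ent (m + 1) :: segment ent r m).take 4 := by
  have h1 : segEnd r (m + 1) = m + 1 := by unfold segEnd; omega
  have h2 : segEnd r m = m := by unfold segEnd; omega
  have h3 : (ent (m + 1) :: segment ent r m).length ≤ 4 := by
    simp only [segment, h2, List.length_cons, List.length_map, List.length_range]
    omega
  rw [List.take_of_length_le h3, segment, segment, h1, h2, show m + 1 - 4 * r = (m - 4 * r) + 1 by omega,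
    List.range_succ_eq_map, List.map_cons, List.map_map]
  congr 1
  refine List.map_congr_left fun d _ => ?_
  simp only [Function.comp]
  congr 1
  omega

theorem segment_succ_of_ne {ent : ℕ → Entry} {r m : ℕ} (h : r ≠ m / 4) :
    segment ent r (m + 1) = segment ent r m := by
  rcases Nat.lt_or_ge r (m / 4) with h' | h'
  · rw [segment, segment, show segEnd r (m + 1) = segEnd r m by unfold segEnd; omega]
  · rw [segment, segment, show segEnd r (m + 1) - 4 * r = 0 by unfold segEnd; omega,
      show segEnd r m - 4 * r = 0 by unfold segEnd; omega]
    rfl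

/-- The situation before step `m` of the walk. -/
structure Boundary (c : ℕ → Config V k) (rank : Fin k → ℕ) (z : Fin k) (m : ℕ) (i : Fin k) :
    Prop where
  pos : (c (32 * m)).pos i = walk c z (segEnd (rank i) m)
  hist : (mem ((c (32 * m)).state i)).hist = segment (entry c z) (rank i) m
  x : m / 4 ≤ rank i → (mem ((c (32 * m)).state i)).x = count c z m

/-- The place on the walk of the patroller of rank `r` in round `o` of a batch. -/
def patrolIx (r m o : ℕ) : ℕ := max (segEnd r m - swing o) (4 * r)

theorem patrolIx_le {r m : ℕ} (h : r ≤ m / 4) (o : ℕ) : patrolIx r m o ≤ m := by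
  unfold patrolIx segEnd; omega

/-! ### The motion of the patrollers. -/

namespace IsRun

theorem hist_const (h : IsRun p c rank z s) {m : ℕ} (hm : m < 2 * k) (i : Fin k) {τ : ℕ}
    (hτ : τ ≤ 31) : (mem ((c (32 * m + τ)).state i)).hist = (mem ((c (32 * m)).state i)).hist := by
  induction τ with
  | zero => rfl
  | succ τ ih =>
    rw [← ih (by omega), ← Nat.add_assoc, (h.grow_succ hm (by omega) i rfl).1]
    refine Mem.grow_hist (fun h31 => ?_) _ _ _ _
    have := (h.lead_offset hm (τ := τ) (by omega) i).2
    omega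

theorem x_const (h : IsRun p c rank z s) {m : ℕ} (hm : m < 2 * k) (i : Fin k) {τ : ℕ}
    (hτ : τ ≤ 30) : (mem ((c (32 * m + τ)).state i)).x = (mem ((c (32 * m)).state i)).x := by
  induction τ with
  | zero => rfl
  | succ τ ih =>
    rw [← ih (by omega), ← Nat.add_assoc, (h.grow_succ hm (by omega) i rfl).1]
    refine Mem.grow_x (fun h31 => ?_) _ _ _ _
    have := (h.lead_offset hm (τ := τ) (by omega) i).2
    omega

/-- On a segment shorter than four steps the missing entries read as `default`, with port `0`: the
patroller waits at the start of the segment, which is the `max` in `patrolIx`. -/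
theorem nbr_patrolPort {w : ℕ → V} {ent : ℕ → Entry} {X : ℕ → ℕ} {m : ℕ}
    (hw : IsDFSWalk p k w ent X m) {r o : ℕ} (hr : r ≤ m / 4) (ho : o < 10) {a : Mem}
    (ha : a.hist = segment ent r m) :
    p.nbr (w (patrolIx r m o)) (a.patrolPort o) = w (patrolIx r m ((o + 1) % 10)) := by
  have he : 4 * r ≤ segEnd r m ∧ segEnd r m ≤ m := by unfold segEnd; omega
  unfold Mem.patrolPort
  rw [ha]
  split_ifs with h1 h2
  · have hs : swing o = o - 1 ∧ swing ((o + 1) % 10) = o := by unfold swing; omega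
    by_cases hd : o - 1 < segEnd r m - 4 * r
    · rw [segment_getD hd]
      have hb := hw.back (segEnd r m - o) (by omega)
      rw [show segEnd r m - o + 1 = segEnd r m - (o - 1) by omega] at hb
      rw [show patrolIx r m o = segEnd r m - (o - 1) by unfold patrolIx; omega, ← hb]
      congr 1
      unfold patrolIx; omega
    · rw [segment_getD_of_le (by omega)]
      change p.nbr _ 0 = _
      rw [nbr_zero]
      congr 1
      unfold patrolIx; omega
  · have hs : swing o = 9 - o ∧ swing ((o + 1) % 10) = 8 - o := by unfold swing; omega
    by_cases hd : 8 - o < segEnd r m - 4 * r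
    · rw [segment_getD hd]
      have hb := hw.forth (segEnd r m - (9 - o)) (by omega)
      rw [show segEnd r m - (9 - o) + 1 = segEnd r m - (8 - o) by omega] at hb
      rw [show patrolIx r m o = segEnd r m - (9 - o) by unfold patrolIx; omega, ← hb]
      congr 1
      unfold patrolIx; omega
    · rw [segment_getD_of_le (by omega)]
      change p.nbr _ 0 = _
      rw [nbr_zero]
      congr 1
      unfold patrolIx; omega
  · have hs : swing o = 0 ∧ swing ((o + 1) % 10) = 0 := by unfold swing; omega
    rw [nbr_zero]
    congr 1
    unfold patrolIx; omega

/-- Where the patrollers are. -/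
theorem patrol (h : IsRun p c rank z s) {m : ℕ} (hm : m < 2 * k)
    (hw : IsDFSWalk p k (walk c z) (entry c z) (count c z) m) (hB : ∀ i, Boundary c rank z m i)
    {i : Fin k} (hi : rank i ≤ m / 4) {τ : ℕ} (hτ : τ ≤ 30) :
    (c (32 * m + τ)).pos i = walk c z (patrolIx (rank i) m (τ % 10)) := by
  induction τ with
  | zero =>
    rw [Nat.add_zero, (hB i).pos]
    congr 1
    unfold patrolIx swing segEnd; omega
  | succ τ ih =>
    obtain ⟨h1, h2⟩ := h.lead_offset hm (τ := τ) (by omega) i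
    have hb := h.basic (t := 32 * m + τ) (by omega) i
    have hg := (h.grow_succ hm (τ := τ) (by omega) i rfl).2.1
    rw [Mem.grow, if_pos (by omega), if_pos (by rw [hb.rk, h1]; exact hi), ih (by omega), h2,
      nbr_patrolPort hw hi (Nat.mod_lt _ (by norm_num))
        ((h.hist_const hm i (by omega)).trans (hB i).hist)] at hg
    rw [← Nat.add_assoc, hg]
    congr 2
    omega

/-- Every visited node is met by a patroller in each batch. -/
theorem exists_patrol (h : IsRun p c rank z s) {m : ℕ} (hm : m < 2 * k) {w : ℕ → V} {u : V}
    (hu : Visited w m u) :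
    ∃ o, 1 ≤ o ∧ o ≤ 9 ∧ ∃ i, rank i ≤ m / 4 ∧ w (patrolIx (rank i) m o) = u := by
  obtain ⟨q, hq, rfl⟩ := hu
  -- Step `q` belongs to rank `(q - 1) / 4`; truncated subtraction gives the start node to rank 0.
  -- Rounds 1 to 5 sweep the distances 0 to 4 from the segment's end, so the meeting happens in the
  -- round numbered distance plus one.
  obtain ⟨i, hi⟩ := h.exists_rank (r := (q - 1) / 4) (by omega)
  refine ⟨segEnd (rank i) m - q + 1, by omega, by rw [hi]; unfold segEnd; omega, i, by omega, ?_⟩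
  congr 1
  rw [hi]
  unfold patrolIx swing segEnd; omega

end IsRun

end Run

section Seek

variable {V : Type*} [Fintype V] [DecidableEq V] {G : SimpleGraph V} [DecidableRel G.Adj] {k : ℕ}

/-! ### The search for an undiscovered neighbour -/

/-- What the prober `a` of the node `u`, sent out from `w m` through port `q`, has learned when it
has made the observations of the first `n` rounds; `n₀` counts the rounds of the current batch. -/
structure Watch (w : ℕ → V) (ent : ℕ → Entry) (rank : Fin k → ℕ) (m n₀ n : ℕ) (u : V)
    (a : Mem) : Prop where
  saw_sound : a.saw = true → Visited w m u
  saw_complete : ∀ o, 1 ≤ o → o < n₀ → ∀ i, rank i ≤ m / 4 → w (patrolIx (rank i) m o) = u →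
    a.saw = true
  pp_sound : a.pp ≠ 0 → ∃ q < m, (ent (q + 1)).idx ≠ 0 ∧ w (q + 1) = w m ∧
    a.pp = (ent (q + 1)).inn
  pp_complete : ∀ o, 1 ≤ o → o ≤ 9 → o < n → ∀ i, rank i ≤ m / 4 →
    swing o < segEnd (rank i) m - 4 * rank i → w (segEnd (rank i) m - swing o) = w m →
    (ent (segEnd (rank i) m - swing o)).idx ≠ 0 → (ent (segEnd (rank i) m - swing o)).inn ≤ a.pp

/-- The candidates for undiscovered neighbours of `w m` that a seeker has found in the batches
before batch `b`. -/
structure Found (p : PortLabeling G) (w : ℕ → V) (m r b : ℕ) (a : Mem) : Prop where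
  sound : a.cand ≠ 0 → a.cand ≤ G.degree (w m) ∧ ¬ Visited w m (p.nbr (w m) a.cand)
  complete : ∀ b', 1 ≤ b' → b' < b → Mem.probe (G.degree (w m)) (m / 4) r b' ≠ 0 →
    ¬ Visited w m (p.nbr (w m) (Mem.probe (G.degree (w m)) (m / 4) r b')) → a.cand ≠ 0

/-- A seeker at the start of batch `b`. -/
structure AtHome (p : PortLabeling G) (c : ℕ → Config V k) (rank : Fin k → ℕ) (z : Fin k)
    (m b : ℕ) (i : Fin k) : Prop where
  pos : (c (32 * m + 10 * b)).pos i = walk c z m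
  found : b ≠ 0 → Found p (walk c z) m (rank i) b (mem ((c (32 * m + 10 * b)).state i))
  pp_sound : b ≠ 0 → (mem ((c (32 * m + 10 * b)).state i)).pp ≠ 0 →
    ∃ q < m, (entry c z (q + 1)).idx ≠ 0 ∧ walk c z (q + 1) = walk c z m ∧
      (mem ((c (32 * m + 10 * b)).state i)).pp = (entry c z (q + 1)).inn
  pp_complete : b ≠ 0 → ∀ o, 1 ≤ o → o ≤ 9 → ∀ i', rank i' ≤ m / 4 →
    swing o < segEnd (rank i') m - 4 * rank i' →
    walk c z (segEnd (rank i') m - swing o) = walk c z m →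
    (entry c z (segEnd (rank i') m - swing o)).idx ≠ 0 →
    (entry c z (segEnd (rank i') m - swing o)).inn ≤ (mem ((c (32 * m + 10 * b)).state i)).pp

/-- A seeker in round `o` of batch `b`, after it has left for the node to probe. -/
structure Away (p : PortLabeling G) (c : ℕ → Config V k) (rank : Fin k → ℕ) (z : Fin k)
    (m b o q : ℕ) (i : Fin k) : Prop where
  pos : (c (32 * m + (10 * b + o))).pos i = p.nbr (walk c z m) q
  tgt : (mem ((c (32 * m + (10 * b + o))).state i)).tgt = q
  pin : q ≠ 0 → p.nbr (p.nbr (walk c z m) q) ((c (32 * m + (10 * b + o))).state i).pin = walk c z m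
  found : Found p (walk c z) m (rank i) b (mem ((c (32 * m + (10 * b + o))).state i))
  watch : Watch (walk c z) (entry c z) rank m o (10 * b + o) (p.nbr (walk c z m) q)
    (mem ((c (32 * m + (10 * b + o))).state i))

variable {p : PortLabeling G} {c : ℕ → Config V k} {rank : Fin k → ℕ} {z : Fin k} {s : V}

namespace IsRun

/-- A patroller only stands on visited nodes, so meeting one proves the probed node visited. Parent
hints are accepted only with `tgt = 0`, that is, at `w m` itself, so they concern the right node. -/
theorem watch_observe (h : IsRun p c rank z s) {m : ℕ} (hm : m < 2 * k)
    (hw : IsDFSWalk p k (walk c z) (entry c z) (count c z) m) (hB : ∀ i, Boundary c rank z m i)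
    {i : Fin k} {b o q : ℕ} (hb : b < 3) (ho : 1 ≤ o) (ho' : o ≤ 9) (hq : b = 0 → q = 0)
    (hA : Away p c rank z m b o q i) :
    Watch (walk c z) (entry c z) rank m (o + 1) (10 * b + (o + 1)) (p.nbr (walk c z m) q)
      ((mem ((c (32 * m + (10 * b + o))).state i)).observe
        ((c (32 * m + (10 * b + o))).view i) o) := by
  set τ := 10 * b + o with hτ
  set a := mem ((c (32 * m + τ)).state i) with ha
  have hlead : a.lead = m / 4 := (h.lead_offset hm (by omega) i).1
  have hbas : ∀ i', (mem ((c (32 * m + τ)).state i')).rk = rank i' := fun i' =>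
    (h.basic (by omega) i').rk
  have hpat : ∀ i', rank i' ≤ m / 4 →
      (c (32 * m + τ)).pos i' = walk c z (patrolIx (rank i') m o) := by
    intro i' hi'
    rw [h.patrol hm hw hB hi' (by omega), show τ % 10 = o by omega]
  have hhist : ∀ i', (mem ((c (32 * m + τ)).state i')).hist =
      segment (entry c z) (rank i') m := fun i' =>
    (h.hist_const hm i' (by omega)).trans (hB i').hist
  have htgt : a.tgt = q := hA.tgt
  constructor
  · intro hs
    rcases Bool.or_eq_true_iff.mp hs with hs | hs
    · exact hA.watch.saw_sound hs
    · obtain ⟨x, hx, hxr⟩ := of_decide_eq_true hs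
      obtain ⟨i', hp', rfl⟩ := mem_view.mp hx
      rw [hbas, hlead] at hxr
      rw [hpat i' hxr, hA.pos] at hp'
      exact ⟨_, patrolIx_le hxr o, hp'⟩
  · intro o' h1 h2 i' hi' hwi
    by_cases h3 : o' < o
    · exact Bool.or_eq_true_iff.mpr (Or.inl (hA.watch.saw_complete o' h1 h3 i' hi' hwi))
    · obtain rfl : o' = o := by omega
      refine Bool.or_eq_true_iff.mpr (Or.inr (decide_eq_true ⟨_, mem_view.mpr ⟨i', ?_, rfl⟩, ?_⟩))
      · rw [hpat i' hi', hA.pos, hwi]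
      · rw [hbas, hlead]; exact hi'
  · intro hpp
    by_cases hold : (a.observe ((c (32 * m + τ)).view i) o).pp = a.pp
    · rw [hold] at hpp ⊢
      exact hA.watch.pp_sound hpp
    · simp only [Mem.observe] at hold hpp ⊢
      split_ifs at hold hpp ⊢ with h0
      · rw [htgt] at h0
        have hpos : (c (32 * m + τ)).pos i = walk c z m := by rw [hA.pos, h0, nbr_zero]
        set S := ((c (32 * m + τ)).view i).sup fun s =>
          if (mem s).rk ≤ a.lead then (mem s).parentHint o else 0 with hS
        have hmax : max a.pp S = S := by
          rcases max_choice a.pp S with hc | hc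
          · exact absurd hc hold
          · exact hc
        rw [hmax] at hpp ⊢
        have hne : ((c (32 * m + τ)).view i).Nonempty :=
          ⟨_, mem_view.mpr ⟨i, rfl, rfl⟩⟩
        obtain ⟨x, hx, hxS⟩ := Finset.exists_mem_eq_sup _ hne
          fun s => if (mem s).rk ≤ a.lead then (mem s).parentHint o else 0
        rw [← hS] at hxS
        obtain ⟨i', hp', rfl⟩ := mem_view.mp hx
        rw [hxS] at hpp ⊢
        split_ifs at hpp ⊢ with hxr
        · rw [hbas, hlead] at hxr
          rw [hpat i' hxr, hpos] at hp'
          unfold Mem.parentHint at hpp ⊢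
          rw [hhist] at hpp ⊢
          -- A patroller at the very start of its segment reads past its entries and gives no hint:
          -- the step leading to that node is not in its own record.
          by_cases hd : swing o < segEnd (rank i') m - 4 * rank i'
          · rw [segment_getD hd] at hpp ⊢
            split_ifs at hpp ⊢ with hidx
            · exact absurd rfl hpp
            · have he : segEnd (rank i') m ≤ m := by unfold segEnd; omega
              have e1 : segEnd (rank i') m - swing o - 1 + 1 = segEnd (rank i') m - swing o := by
                omega
              refine ⟨segEnd (rank i') m - swing o - 1, by omega, ?_, ?_, ?_⟩
              · rw [e1]; exact hidx
              · rw [e1, ← hp']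
                congr 1
                unfold patrolIx; omega
              · rw [e1]
          · rw [segment_getD_of_le (by omega)] at hpp
            exact absurd rfl hpp
        · exact absurd rfl hpp
      · exact absurd rfl hold
  · intro o' h1 h2 h3 i' hi' hd hwi hidx
    have hle : a.pp ≤ (a.observe ((c (32 * m + τ)).view i) o).pp := by
      simp only [Mem.observe]
      split_ifs
      · exact le_max_left _ _
      · exact le_rfl
    by_cases h4 : o' < τ
    · exact (hA.watch.pp_complete o' h1 h2 h4 i' hi' hd hwi hidx).trans hle
    · obtain rfl : b = 0 := by omega
      obtain rfl : o' = o := by omega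
      have hq0 := hq rfl
      have hpos : (c (32 * m + τ)).pos i = walk c z m := by rw [hA.pos, hq0, nbr_zero]
      simp only [Mem.observe]
      rw [if_pos (htgt.trans hq0)]
      refine le_max_of_le_right ?_
      have hmem : (c (32 * m + τ)).state i' ∈ (c (32 * m + τ)).view i := by
        refine mem_view.mpr ⟨i', ?_, rfl⟩
        rw [hpat i' hi', hpos, ← hwi]
        congr 1
        unfold patrolIx; omega
      refine le_trans ?_ (Finset.le_sup hmem)
      rw [if_pos (by rw [hbas, hlead]; exact hi'), Mem.parentHint, hhist, segment_getD hd,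
        if_neg hidx]

theorem seek_go (h : IsRun p c rank z s) {m : ℕ} (hm : m < 2 * k) {i : Fin k}
    (hi : m / 4 < rank i) {b : ℕ} (hb : b < 3) (hH : AtHome p c rank z m b i) :
    Away p c rank z m b 1 (Mem.probe (G.degree (walk c z m)) (m / 4) (rank i) b) i := by
  obtain ⟨h1, h2⟩ := h.lead_offset hm (τ := 10 * b) (by omega) i
  have hbas := h.basic (t := 32 * m + 10 * b) (by omega) i
  have hg := h.grow_succ hm (τ := 10 * b) (by omega) i rfl
  rw [Mem.grow, if_pos (by omega), if_neg (by rw [hbas.rk]; omega), h2, Mem.seek,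
    if_pos (by omega), hbas.rk, h1, hH.pos, Nat.add_assoc] at hg
  obtain ⟨g1, g2, g3⟩ := hg
  rw [show 10 * b / 10 = b by omega] at g1 g2 g3
  have hpr := Mem.probe_le (G.degree (walk c z m)) (m / 4) (rank i) b
  refine ⟨g2, by rw [g1]; rfl, fun h0 => (h.pin_of_move hH.pos g2 h0 hpr).1, ?_, ?_⟩
  · by_cases hb0 : b = 0
    · constructor
      · intro hc; rw [g1] at hc; simp [Mem.tick, hb0] at hc
      · intro b' h1 h2; omega
    · have hf := hH.found hb0
      have hc : (mem ((c (32 * m + (10 * b + 1))).state i)).cand =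
          (mem ((c (32 * m + 10 * b)).state i)).cand := by
        rw [g1]; simp [Mem.tick, hb0]
      constructor
      · rw [hc]; exact hf.sound
      · rw [hc]; exact hf.complete
  · constructor
    · intro hs; rw [g1] at hs; simp [Mem.tick] at hs
    · intro o h1 h2; omega
    · by_cases hb0 : b = 0
      · intro hc; rw [g1] at hc; simp [Mem.tick, hb0] at hc
      · have hc : (mem ((c (32 * m + (10 * b + 1))).state i)).pp =
            (mem ((c (32 * m + 10 * b)).state i)).pp := by
          rw [g1]; simp [Mem.tick, hb0]
        rw [hc]; exact hH.pp_sound hb0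
    · intro o h1 h2 h3
      have hb0 : b ≠ 0 := by omega
      have hc : (mem ((c (32 * m + (10 * b + 1))).state i)).pp =
          (mem ((c (32 * m + 10 * b)).state i)).pp := by
        rw [g1]; simp [Mem.tick, hb0]
      rw [hc]; exact hH.pp_complete hb0 o h1 h2

theorem seek_watch (h : IsRun p c rank z s) {m : ℕ} (hm : m < 2 * k)
    (hw : IsDFSWalk p k (walk c z) (entry c z) (count c z) m) (hB : ∀ i, Boundary c rank z m i)
    {i : Fin k} (hi : m / 4 < rank i) {b o q : ℕ} (hb : b < 3) (ho : 1 ≤ o) (ho' : o ≤ 8)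
    (hq : b = 0 → q = 0) (hA : Away p c rank z m b o q i) :
    Away p c rank z m b (o + 1) q i := by
  have hwt := h.watch_observe hm hw hB hb ho (by omega) hq hA
  obtain ⟨h1, h2⟩ := h.lead_offset hm (τ := 10 * b + o) (by omega) i
  have hbas := h.basic (t := 32 * m + (10 * b + o)) (by omega) i
  have hg := h.grow_succ hm (τ := 10 * b + o) (by omega) i rfl
  rw [Mem.grow, if_pos (by omega), if_neg (by rw [hbas.rk]; omega), h2, Mem.seek,
    if_neg (by omega), if_neg (by omega), show (10 * b + o) % 10 = o by omega, nbr_zero,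
    hA.pos, Nat.add_assoc, Nat.add_assoc] at hg
  obtain ⟨g1, g2, g3⟩ := hg
  refine ⟨g2, by rw [g1]; exact hA.tgt, fun h0 => ?_, ?_, ?_⟩
  · have := h.pin_succ (32 * m + (10 * b + o)) i
    rw [Nat.add_assoc, Nat.add_assoc, g2, hA.pos, if_pos rfl] at this
    rw [this]; exact hA.pin h0
  · rw [g1]; exact ⟨hA.found.sound, hA.found.complete⟩
  · rw [g1]; exact ⟨hwt.saw_sound, hwt.saw_complete, hwt.pp_sound, hwt.pp_complete⟩

/-- By round 9 every patroller has swept its whole segment since the departure, so `saw = false`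
certifies that the probed node is unvisited. -/
theorem seek_return (h : IsRun p c rank z s) {m : ℕ} (hm : m < 2 * k)
    (hw : IsDFSWalk p k (walk c z) (entry c z) (count c z) m) (hB : ∀ i, Boundary c rank z m i)
    {i : Fin k} (hi : m / 4 < rank i) {b : ℕ} (hb : b < 3)
    (hA : Away p c rank z m b 9 (Mem.probe (G.degree (walk c z m)) (m / 4) (rank i) b) i) :
    AtHome p c rank z m (b + 1) i := by
  have hpr := Mem.probe_le (G.degree (walk c z m)) (m / 4) (rank i) b
  have hq0 : b = 0 → Mem.probe (G.degree (walk c z m)) (m / 4) (rank i) b = 0 := by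
    intro hb0; simp [Mem.probe, hb0]
  set q := Mem.probe (G.degree (walk c z m)) (m / 4) (rank i) b with hq
  have hwt := h.watch_observe hm hw hB hb (by omega) (by omega) hq0 hA
  obtain ⟨h1, h2⟩ := h.lead_offset hm (τ := 10 * b + 9) (by omega) i
  have hbas := h.basic (t := 32 * m + (10 * b + 9)) (by omega) i
  have hg := h.grow_succ hm (τ := 10 * b + 9) (by omega) i rfl
  rw [Mem.grow, if_pos (by omega), if_neg (by rw [hbas.rk]; omega), h2, Mem.seek,
    if_neg (by omega), if_pos (by omega), show (10 * b + 9) % 10 = 9 by omega,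
    hA.pos, hA.tgt, show 32 * m + (10 * b + 9) + 1 = 32 * m + 10 * (b + 1) by omega] at hg
  obtain ⟨g1, g2, -⟩ := hg
  refine ⟨?_, fun _ => ⟨?_, ?_⟩, fun _ => ?_, fun _ o ho ho' => ?_⟩
  · rw [g2]
    dsimp only
    split_ifs with h0
    · rw [h0, nbr_zero, nbr_zero]
    · exact hA.pin h0
  · rw [g1]
    dsimp only [Mem.tick]
    split_ifs with hc
    · intro _
      refine ⟨hpr, fun hv => ?_⟩
      obtain ⟨o, ho, ho', i', hi', hwi⟩ := h.exists_patrol hm hv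
      rw [hwt.saw_complete o ho (by omega) i' hi' hwi] at hc
      exact absurd hc.1 (by decide)
    · exact hA.found.sound
  · intro b' hb1 hb2 hb3 hb4
    rw [g1]
    dsimp only [Mem.tick]
    split_ifs with hc
    · exact hc.2
    · by_cases hbb : b' < b
      · exact hA.found.complete b' hb1 hbb hb3 hb4
      · obtain rfl : b' = b := by omega
        refine absurd ⟨?_, hb3⟩ hc
        rw [Bool.eq_false_iff]
        exact fun hs => hb4 (hwt.saw_sound hs)
  · rw [g1]; exact hwt.pp_sound
  · rw [g1]; exact hwt.pp_complete o ho ho' (by omega)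

theorem atHome (h : IsRun p c rank z s) {m : ℕ} (hm : m < 2 * k)
    (hw : IsDFSWalk p k (walk c z) (entry c z) (count c z) m) (hB : ∀ i, Boundary c rank z m i)
    {i : Fin k} (hi : m / 4 < rank i) {b : ℕ} (hb : b ≤ 3) : AtHome p c rank z m b i := by
  induction b with
  | zero =>
    refine ⟨?_, by simp, by simp, by simp⟩
    rw [Nat.mul_zero, Nat.add_zero, (hB i).pos, show segEnd (rank i) m = m by unfold segEnd; omega]
  | succ b ih =>
    have hq : b = 0 → Mem.probe (G.degree (walk c z m)) (m / 4) (rank i) b = 0 := by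
      intro hb0; simp [Mem.probe, hb0]
    have key : ∀ o, o ≤ 8 → Away p c rank z m b (o + 1)
        (Mem.probe (G.degree (walk c z m)) (m / 4) (rank i) b) i := by
      intro o
      induction o with
      | zero => intro _; exact h.seek_go hm hi (by omega) (ih (by omega))
      | succ o iho =>
        intro ho
        exact h.seek_watch hm hw hB hi (by omega) (by omega) (by omega) hq (iho (by omega))
    exact h.seek_return hm hw hB hi (by omega) (key 8 le_rfl)

end IsRun

end Seek

section Advance

variable {V : Type*} [Fintype V] [DecidableEq V] {G : SimpleGraph V} [DecidableRel G.Adj] {k : ℕ}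
variable {p : PortLabeling G} {c : ℕ → Config V k} {rank : Fin k → ℕ} {z : Fin k} {s : V}

/-! ### One step of the walk -/

namespace IsRun

theorem pos_group (h : IsRun p c rank z s) {m : ℕ} (hm : m < 2 * k)
    (hw : IsDFSWalk p k (walk c z) (entry c z) (count c z) m) (hB : ∀ i, Boundary c rank z m i)
    {i : Fin k} (hi : m / 4 ≤ rank i) : (c (32 * m + 30)).pos i = walk c z m := by
  rcases Nat.eq_or_lt_of_le hi with hi | hi
  · rw [h.patrol hm hw hB hi.ge le_rfl]
    congr 1
    unfold patrolIx swing segEnd; omega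
  · exact (h.atHome hm hw hB hi (b := 3) le_rfl).pos

theorem rank_z_ge (h : IsRun p c rank z s) {m : ℕ} (hm : m ≤ 2 * k) : m / 4 ≤ rank z := by
  have := h.pos_k
  have := h.last
  omega

theorem rank_z_gt (h : IsRun p c rank z s) {m : ℕ} (hm : m < 2 * k) (hk : 2 ≤ k) :
    m / 4 < rank z := by
  have := h.last
  omega

theorem bestCand_sound (h : IsRun p c rank z s) {m : ℕ} (hm : m < 2 * k)
    (hw : IsDFSWalk p k (walk c z) (entry c z) (count c z) m) (hB : ∀ i, Boundary c rank z m i)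
    (hC : Mem.bestCand (m / 4) ((c (32 * m + 30)).view z) ≠ 0) :
    Mem.bestCand (m / 4) ((c (32 * m + 30)).view z) ≤ G.degree (walk c z m) ∧
      ¬ Visited (walk c z) m (p.nbr (walk c z m)
        (Mem.bestCand (m / 4) ((c (32 * m + 30)).view z))) := by
  obtain ⟨x, hx, hxS⟩ := Finset.exists_mem_eq_sup ((c (32 * m + 30)).view z)
    ⟨_, mem_view.mpr ⟨z, rfl, rfl⟩⟩ fun s => if m / 4 < (mem s).rk then (mem s).cand else 0
  change Mem.bestCand _ _ = _ at hxS
  rw [hxS] at hC ⊢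
  obtain ⟨i, -, rfl⟩ := mem_view.mp hx
  split_ifs at hC ⊢ with hr
  · rw [(h.basic (by omega) i).rk] at hr
    exact ((h.atHome hm hw hB hr (b := 3) le_rfl).found (by omega)).sound hC
  · exact absurd rfl hC

theorem bestCand_complete (h : IsRun p c rank z s) {m : ℕ} (hm : m < 2 * k)
    (hw : IsDFSWalk p k (walk c z) (entry c z) (count c z) m) (hB : ∀ i, Boundary c rank z m i)
    (hx : count c z m < k)
    (hC : Mem.bestCand (m / 4) ((c (32 * m + 30)).view z) = 0) (u : V)
    (hu : G.Adj (walk c z m) u) : Visited (walk c z) m u := by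
  by_contra hv
  obtain ⟨q, hq1, hq2, hq3, hq4⟩ := hw.exists_port hx hu hv
  -- The seekers share the ports in pairs from rank `m / 4 + 1` on. This rank is below `k` because
  -- `q ≤ k - 1` and `m < 2 * k`; the estimate is tight.
  obtain ⟨i, hi⟩ := h.exists_rank (r := m / 4 + 1 + (q - 1) / 2) (by omega)
  have hH := h.atHome hm hw hB (i := i) (b := 3) (by omega) le_rfl
  have hpr : Mem.probe (G.degree (walk c z m)) (m / 4) (rank i) ((q - 1) % 2 + 1) = q := by
    have e : 2 * (rank i - m / 4 - 1) + ((q - 1) % 2 + 1) = q := by omega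
    rw [Mem.probe, if_neg (by omega), e, if_pos hq2]
  have hne := (hH.found (by omega)).complete ((q - 1) % 2 + 1) (by omega) (by omega)
    (by omega) (by rwa [hpr])
  have hmem : (c (32 * m + 30)).state i ∈ (c (32 * m + 30)).view z := by
    refine mem_view.mpr ⟨i, ?_, rfl⟩
    rw [h.pos_group hm hw hB (by omega), h.pos_group hm hw hB (h.rank_z_ge hm.le)]
  have hle := Finset.le_sup (f := fun s => if m / 4 < (mem s).rk then (mem s).cand else 0) hmem
  change _ ≤ Mem.bestCand _ _ at hle
  rw [hC, if_pos (by rw [(h.basic (by omega) i).rk]; omega)] at hle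
  exact hne (Nat.le_zero.mp hle)

theorem bestParent_sound (h : IsRun p c rank z s) {m : ℕ} (hm : m < 2 * k)
    (hw : IsDFSWalk p k (walk c z) (entry c z) (count c z) m) (hB : ∀ i, Boundary c rank z m i)
    (hC : Mem.bestParent (m / 4) ((c (32 * m + 30)).view z) ≠ 0) :
    ∃ q < m, (entry c z (q + 1)).idx ≠ 0 ∧ walk c z (q + 1) = walk c z m ∧
      Mem.bestParent (m / 4) ((c (32 * m + 30)).view z) = (entry c z (q + 1)).inn := by
  obtain ⟨x, hx, hxS⟩ := Finset.exists_mem_eq_sup ((c (32 * m + 30)).view z)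
    ⟨_, mem_view.mpr ⟨z, rfl, rfl⟩⟩ fun s => if m / 4 < (mem s).rk then (mem s).pp else 0
  change Mem.bestParent _ _ = _ at hxS
  rw [hxS] at hC ⊢
  obtain ⟨i, -, rfl⟩ := mem_view.mp hx
  split_ifs at hC ⊢ with hr
  · rw [(h.basic (by omega) i).rk] at hr
    exact (h.atHome hm hw hB hr (b := 3) le_rfl).pp_sound (by omega) hC
  · exact absurd rfl hC

/-- The patroller of rank `q / 4` passes the current node while agent `z` is at home and delivers
the port. The supremum cannot pick a different one, since a node is discovered only once. -/
theorem bestParent_complete (h : IsRun p c rank z s) {m : ℕ} (hm : m < 2 * k)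
    (hw : IsDFSWalk p k (walk c z) (entry c z) (count c z) m) (hB : ∀ i, Boundary c rank z m i)
    (hk : 2 ≤ k) {q : ℕ} (hq : q < m) (hidx : (entry c z (q + 1)).idx ≠ 0)
    (hwq : walk c z (q + 1) = walk c z m) :
    Mem.bestParent (m / 4) ((c (32 * m + 30)).view z) = (entry c z (q + 1)).inn := by
  obtain ⟨-, -, hnv, hin, -⟩ := hw.fresh q hq hidx
  have hle : (entry c z (q + 1)).inn ≤ Mem.bestParent (m / 4) ((c (32 * m + 30)).view z) := by
    have hz := h.rank_z_gt hm hk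
    obtain ⟨i, hi⟩ := h.exists_rank (r := q / 4) (by omega)
    have e : segEnd (rank i) m - swing (segEnd (rank i) m - (q + 1) + 1) = q + 1 := by
      rw [hi]; unfold swing segEnd; omega
    have hpc := (h.atHome hm hw hB hz (b := 3) le_rfl).pp_complete (by omega)
      (segEnd (rank i) m - (q + 1) + 1) (by omega) (by unfold segEnd; omega) i (by omega)
      (by rw [hi]; unfold swing segEnd; omega)
    rw [e] at hpc
    refine (hpc hwq hidx).trans ?_
    have hle := Finset.le_sup (f := fun s => if m / 4 < (mem s).rk then (mem s).pp else 0)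
      (mem_view.mpr ⟨z, rfl, rfl⟩ : (c (32 * m + 30)).state z ∈ (c (32 * m + 30)).view z)
    rwa [if_pos (by rw [(h.basic (by omega) z).rk]; exact hz)] at hle
  obtain ⟨q', hq', hidx', hwq', heq⟩ := h.bestParent_sound hm hw hB (by omega)
  obtain ⟨-, -, hnv', -⟩ := hw.fresh q' hq' hidx'
  rcases Nat.lt_trichotomy q q' with hlt | rfl | hlt
  · exact absurd ⟨q + 1, by omega, by rw [hwq, hwq']⟩ hnv'
  · exact heq
  · exact absurd ⟨q' + 1, by omega, by rw [hwq, hwq']⟩ hnv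

/-- The port through which the group makes step `m + 1` of the walk. -/
noncomputable def outPort (c : ℕ → Config V k) (z : Fin k) (m : ℕ) : ℕ :=
  ((mem ((c (32 * m + 30)).state z)).advance ((c (32 * m + 30)).view z)).2

/-- All agents of the group stand at one node, hence have the same view and the same `x`, and reach
the same decision. -/
theorem advance_eq (h : IsRun p c rank z s) {m : ℕ} (hm : m < 2 * k)
    (hw : IsDFSWalk p k (walk c z) (entry c z) (count c z) m) (hB : ∀ i, Boundary c rank z m i)
    {i : Fin k} (hi : m / 4 ≤ rank i) :
    (c (32 * m + 31)).pos i = p.nbr (walk c z m) (outPort c z m) ∧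
      ((c (32 * m + 31)).state i).pout = outPort c z m ∧
      (count c z m < k →
        (Mem.bestCand (m / 4) ((c (32 * m + 30)).view z) ≠ 0 →
          outPort c z m = Mem.bestCand (m / 4) ((c (32 * m + 30)).view z) ∧
          (mem ((c (32 * m + 31)).state i)).x = count c z m + 1 ∧
          (mem ((c (32 * m + 31)).state i)).nw = count c z m) ∧
        (Mem.bestCand (m / 4) ((c (32 * m + 30)).view z) = 0 →
          outPort c z m = Mem.bestParent (m / 4) ((c (32 * m + 30)).view z) ∧
          (mem ((c (32 * m + 31)).state i)).x = count c z m ∧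
          (mem ((c (32 * m + 31)).state i)).nw = 0)) ∧
      (¬ count c z m < k → outPort c z m = 0 ∧
          (mem ((c (32 * m + 31)).state i)).x = count c z m ∧
          (mem ((c (32 * m + 31)).state i)).nw = 0) := by
  have hz := h.rank_z_ge hm.le
  have hview : (c (32 * m + 30)).view i = (c (32 * m + 30)).view z := by
    unfold Config.view
    rw [h.pos_group hm hw hB hi, h.pos_group hm hw hB hz]
  obtain ⟨h1, h2⟩ := h.lead_offset hm (τ := 30) (by omega) i
  obtain ⟨h1z, -⟩ := h.lead_offset hm (τ := 30) (by omega) z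
  have hbas := h.basic (t := 32 * m + 30) (by omega) i
  have hbasz := h.basic (t := 32 * m + 30) (by omega) z
  have hx : (mem ((c (32 * m + 30)).state i)).x = count c z m :=
    (h.x_const hm i le_rfl).trans ((hB i).x hi)
  have hxz : (mem ((c (32 * m + 30)).state z)).x = count c z m :=
    (h.x_const hm z le_rfl).trans ((hB z).x hz)
  have hg := h.grow_succ hm (τ := 30) (by omega) i rfl
  rw [Mem.grow, if_neg (by omega), if_pos (by omega), if_neg (by rw [hbas.rk]; omega), hview,
    h.pos_group hm hw hB hi, Mem.advance, h1, hx, hbas.k] at hg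
  rw [outPort, Mem.advance, h1z, hxz, hbasz.k]
  obtain ⟨g1, g2, g3⟩ := hg
  by_cases hc : count c z m < k
  · simp only [if_pos hc] at g1 g2 g3 ⊢
    by_cases hC : Mem.bestCand (m / 4) ((c (32 * m + 30)).view z) = 0
    · rw [if_neg (not_not.mpr hC)] at g1 g2 g3 ⊢
      refine ⟨g2, g3, fun _ => ⟨fun h => absurd hC h, fun _ => ⟨rfl, ?_, ?_⟩⟩,
        fun h => absurd hc h⟩
      · rw [g1]; rfl
      · rw [g1]; rfl
    · rw [if_pos hC] at g1 g2 g3 ⊢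
      refine ⟨g2, g3, fun _ => ⟨fun _ => ⟨rfl, ?_, ?_⟩, fun h => absurd h hC⟩,
        fun h => absurd hc h⟩
      · rw [g1]; rfl
      · rw [g1]; rfl
  · simp only [if_neg hc] at g1 g2 g3 ⊢
    refine ⟨g2, g3, fun h => absurd h hc, fun _ => ⟨trivial, ?_, ?_⟩⟩
    · rw [g1]; rfl
    · rw [g1]; rfl

theorem outPort_le (h : IsRun p c rank z s) {m : ℕ} (hm : m < 2 * k)
    (hw : IsDFSWalk p k (walk c z) (entry c z) (count c z) m) (hB : ∀ i, Boundary c rank z m i) :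
    outPort c z m ≤ G.degree (walk c z m) := by
  obtain ⟨-, -, h3, h4⟩ := h.advance_eq hm hw hB (h.rank_z_ge hm.le)
  by_cases hc : count c z m < k
  · by_cases hC : Mem.bestCand (m / 4) ((c (32 * m + 30)).view z) = 0
    · rw [((h3 hc).2 hC).1]
      by_cases hQ : Mem.bestParent (m / 4) ((c (32 * m + 30)).view z) = 0
      · omega
      · obtain ⟨q, hq, hidx, hwq, heq⟩ := h.bestParent_sound hm hw hB hQ
        rw [heq, ← hwq]
        exact (hw.fresh q hq hidx).2.2.2.2.1
    · rw [((h3 hc).1 hC).1]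
      exact (h.bestCand_sound hm hw hB hC).1
  · rw [(h4 hc).1]; omega

theorem pos_record (h : IsRun p c rank z s) {m : ℕ} (hm : m < 2 * k) (i : Fin k) :
    (c (32 * (m + 1))).pos i = (c (32 * m + 31)).pos i ∧
      (mem ((c (32 * (m + 1))).state i)).x = (mem ((c (32 * m + 31)).state i)).x := by
  obtain ⟨h1, h2⟩ := h.lead_offset hm (τ := 31) (by omega) i
  have hg := h.grow_succ hm (τ := 31) (by omega) i rfl
  rw [Mem.grow, if_neg (by omega), if_neg (by omega)] at hg
  rw [show 32 * (m + 1) = 32 * m + 31 + 1 by omega]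
  obtain ⟨g1, g2, -⟩ := hg
  refine ⟨?_, ?_⟩
  · rw [g2]; split_ifs <;> exact nbr_zero _ _
  · rw [g1]; split_ifs <;> rfl

theorem walk_succ (h : IsRun p c rank z s) {m : ℕ} (hm : m < 2 * k)
    (hw : IsDFSWalk p k (walk c z) (entry c z) (count c z) m) (hB : ∀ i, Boundary c rank z m i) :
    walk c z (m + 1) = p.nbr (walk c z m) (outPort c z m) := by
  rw [walk, (h.pos_record hm z).1, (h.advance_eq hm hw hB (h.rank_z_ge hm.le)).1]

/-- The leader, not `z`, does the recording, but any member of the group would record the same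
entry. After a step without a move `pin` is stale; writing `0` instead keeps the step undoable. -/
theorem entry_succ (h : IsRun p c rank z s) {m : ℕ} (hm : m < 2 * k)
    (hw : IsDFSWalk p k (walk c z) (entry c z) (count c z) m) (hB : ∀ i, Boundary c rank z m i)
    {i : Fin k} (hi : m / 4 ≤ rank i) :
    (⟨((c (32 * m + 31)).state i).pout,
      if ((c (32 * m + 31)).state i).pout = 0 then 0 else ((c (32 * m + 31)).state i).pin,
      (mem ((c (32 * m + 31)).state i)).nw⟩ : Entry) =
    ⟨outPort c z m, if outPort c z m = 0 then 0 else p.label (walk c z (m + 1)) (walk c z m),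
      (mem ((c (32 * m + 31)).state z)).nw⟩ := by
  have hzr := h.rank_z_ge hm.le
  obtain ⟨h1, h2, h3, h4⟩ := h.advance_eq hm hw hB hi
  obtain ⟨-, -, z3, z4⟩ := h.advance_eq hm hw hB hzr
  have hnw : (mem ((c (32 * m + 31)).state i)).nw = (mem ((c (32 * m + 31)).state z)).nw := by
    by_cases hc : count c z m < k
    · by_cases hC : Mem.bestCand (m / 4) ((c (32 * m + 30)).view z) = 0
      · rw [((h3 hc).2 hC).2.2, ((z3 hc).2 hC).2.2]
      · rw [((h3 hc).1 hC).2.2, ((z3 hc).1 hC).2.2]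
    · rw [(h4 hc).2.2, (z4 hc).2.2]
  rw [h2, hnw]
  by_cases h0 : outPort c z m = 0
  · rw [if_pos h0, if_pos h0]
  · rw [if_neg h0, if_neg h0, (h.pin_of_move (t := 32 * m + 30) (h.pos_group hm hw hB hi) h1 h0
      (h.outPort_le hm hw hB)).2.2.2, h.walk_succ hm hw hB]

theorem entry_succ_eq (h : IsRun p c rank z s) {m : ℕ} (hm : m < 2 * k)
    (hw : IsDFSWalk p k (walk c z) (entry c z) (count c z) m) (hB : ∀ i, Boundary c rank z m i) :
    entry c z (m + 1) =
    ⟨outPort c z m, if outPort c z m = 0 then 0 else p.label (walk c z (m + 1)) (walk c z m),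
      (mem ((c (32 * m + 31)).state z)).nw⟩ := by
  rw [← h.entry_succ hm hw hB (h.rank_z_ge hm.le), entry,
    show 32 * (m + 1) - 1 = 32 * m + 31 by omega]

theorem count_succ (h : IsRun p c rank z s) {m : ℕ} (hm : m < 2 * k) :
    count c z (m + 1) = (mem ((c (32 * m + 31)).state z)).x := by
  rw [count, (h.pos_record hm z).2]

/-- The three cases are the branches of `advance`. A root without a parent needs no separate
treatment: the condition on the parent is then vacuous, and `IsDFSWalk.succ` excludes that
situation. -/
theorem isDFSStep (h : IsRun p c rank z s) {m : ℕ} (hm : m < 2 * k)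
    (hw : IsDFSWalk p k (walk c z) (entry c z) (count c z) m) (hB : ∀ i, Boundary c rank z m i) :
    IsDFSStep p k (walk c z) (entry c z) (count c z) m := by
  have hws := h.walk_succ hm hw hB
  have hes := h.entry_succ_eq hm hw hB
  have hcs := h.count_succ hm
  have hle := h.outPort_le hm hw hB
  obtain ⟨-, -, z3, z4⟩ := h.advance_eq hm hw hB (h.rank_z_ge hm.le)
  have hadj : outPort c z m ≠ 0 → G.Adj (walk c z (m + 1)) (walk c z m) := fun h0 => by
    rw [hws]; exact (adj_nbr p h0 hle).symm
  refine ⟨by rw [hes]; exact hws, ?_, ?_⟩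
  · rw [hes]
    dsimp only
    split_ifs with h0
    · rw [nbr_zero, hws, h0, nbr_zero]
    · rw [nbr_label p (hadj h0)]
  · by_cases hc : count c z m < k
    · by_cases hC : Mem.bestCand (m / 4) ((c (32 * m + 30)).view z) = 0
      · obtain ⟨y1, y2, y3⟩ := (z3 hc).2 hC
        refine Or.inr (Or.inl ⟨hc, h.bestCand_complete hm hw hB hc hC, ?_, ?_, ?_⟩)
        · rw [hes]; exact y3
        · rw [hcs]; exact y2
        · intro q hq hidx hwq
          have := hw.one_le
          rw [hws, y1, h.bestParent_complete hm hw hB (by omega) hq hidx hwq, hw.back q hq, hwq]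
      · obtain ⟨y1, y2, y3⟩ := (z3 hc).1 hC
        obtain ⟨-, hnv⟩ := h.bestCand_sound hm hw hB hC
        have h0 : outPort c z m ≠ 0 := by rw [y1]; exact hC
        have hl := label_mem p (hadj h0)
        refine Or.inl ⟨hc, ?_, ?_, ?_, ?_, ?_⟩
        · rw [hws, y1]; exact hnv
        · rw [hes]; exact y3
        · rw [hcs]; exact y2
        · rw [hes]
          simp only [if_neg h0]
          exact Nat.one_le_iff_ne_zero.mp hl.1
        · rw [hes]
          simp only [if_neg h0]
          exact hl.2
    · obtain ⟨y1, y2, y3⟩ := z4 hc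
      have := hw.le
      refine Or.inr (Or.inr ⟨by omega, ?_, ?_, ?_⟩)
      · rw [hws, y1, nbr_zero]
      · rw [hes]; exact y3
      · rw [hcs]; exact y2

theorem boundary_succ (h : IsRun p c rank z s) {m : ℕ} (hm : m < 2 * k)
    (hw : IsDFSWalk p k (walk c z) (entry c z) (count c z) m) (hB : ∀ i, Boundary c rank z m i)
    (i : Fin k) : Boundary c rank z (m + 1) i := by
  obtain ⟨hp, hx⟩ := h.pos_record hm i
  obtain ⟨h1, h2⟩ := h.lead_offset hm (τ := 31) (by omega) i
  have hbas := h.basic (t := 32 * m + 31) (by omega) i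
  have hhist := (h.hist_const hm i (le_refl 31)).trans (hB i).hist
  refine ⟨?_, ?_, ?_⟩
  · rw [hp]
    by_cases hi : m / 4 ≤ rank i
    · rw [(h.advance_eq hm hw hB hi).1, ← h.walk_succ hm hw hB]
      congr 1
      unfold segEnd; omega
    · obtain ⟨h1', h2'⟩ := h.lead_offset hm (τ := 30) (by omega) i
      have hbas' := h.basic (t := 32 * m + 30) (by omega) i
      have hg := (h.grow_succ hm (τ := 30) (by omega) i rfl).2.1
      rw [Mem.grow, if_neg (by omega), if_pos (by omega), if_pos (by rw [hbas'.rk]; omega),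
        nbr_zero, h.patrol hm hw hB (by omega) le_rfl] at hg
      rw [hg]
      congr 1
      unfold patrolIx swing segEnd; omega
  · have hg := (h.grow_succ hm (τ := 31) (by omega) i rfl).1
    rw [Mem.grow, if_neg (by omega), if_neg (by omega), hbas.rk, h1] at hg
    rw [show 32 * (m + 1) = 32 * m + 31 + 1 by omega, hg]
    split_ifs with hr
    · rw [segment_succ_lead hr, h.entry_succ_eq hm hw hB, ← h.entry_succ hm hw hB hr.ge, ← hhist]
      rfl
    · rw [segment_succ_of_ne hr, ← hhist]
      rfl
  · intro hi
    rw [hx, h.count_succ hm]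
    obtain ⟨-, -, h3, h4⟩ := h.advance_eq hm hw hB (i := i) (by omega)
    obtain ⟨-, -, z3, z4⟩ := h.advance_eq hm hw hB (h.rank_z_ge hm.le)
    by_cases hc : count c z m < k
    · by_cases hC : Mem.bestCand (m / 4) ((c (32 * m + 30)).view z) = 0
      · rw [((h3 hc).2 hC).2.1, ((z3 hc).2 hC).2.1]
      · rw [((h3 hc).1 hC).2.1, ((z3 hc).1 hC).2.1]
    · rw [(h4 hc).2.1, (z4 hc).2.1]

theorem count_zero (h : IsRun p c rank z s) : count c z 0 = 1 := by
  simp [count, h.mem_zero]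

/-- The group walks depth first until `k` nodes are discovered. -/
theorem dfs (h : IsRun p c rank z s) (hG : G.Connected) (hk : k ≤ Fintype.card V) {m : ℕ}
    (hm : m ≤ 2 * k) : IsDFSWalk p k (walk c z) (entry c z) (count c z) m ∧
      ∀ i, Boundary c rank z m i := by
  induction m with
  | zero =>
    refine ⟨isDFSWalk_zero h.pos_k h.count_zero, fun i => ⟨?_, ?_, fun _ => ?_⟩⟩
    · simp [walk, segEnd, h.pos_zero]
    · simp [h.mem_zero, segment, segEnd, default]
    · simp [h.mem_zero, count]
  | succ m ih =>
    obtain ⟨hw, hB⟩ := ih (by omega)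
    exact ⟨hw.succ (h.isDFSStep (by omega) hw hB) hG hk, h.boundary_succ (by omega) hw hB⟩

end IsRun

end Advance

section Retreat

variable {V : Type*} [Fintype V] [DecidableEq V] {G : SimpleGraph V} [DecidableRel G.Adj] {k : ℕ}
variable {p : PortLabeling G} {c : ℕ → Config V k} {rank : Fin k → ℕ} {z : Fin k} {s : V}

/-! ### The retreat along the walk -/

/-- Agent `i` when the last `y` steps of the walk are undone: it has settled on the node that has
its rank as index, or it is on the part of the walk not yet undone. -/
structure Retreating (c : ℕ → Config V k) (rank : Fin k → ℕ) (z : Fin k) (y : ℕ) (i : Fin k) :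
    Prop where
  card : (mem ((c (64 * k + y)).state i)).k = k
  rk : (mem ((c (64 * k + y)).state i)).rk = rank i
  hist : (mem ((c (64 * k + y)).state i)).hist = segment (entry c z) (rank i) (2 * k)
  cases : ((mem ((c (64 * k + y)).state i)).st = true ∧ rank i ≠ 0 ∧ ∃ q, 2 * k - y ≤ q ∧
      q < 2 * k ∧ (entry c z (q + 1)).idx = rank i ∧
      (c (64 * k + y)).pos i = walk c z (q + 1)) ∨
    ((mem ((c (64 * k + y)).state i)).st = false ∧
      (mem ((c (64 * k + y)).state i)).t = 64 * k + y ∧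
      (c (64 * k + y)).pos i = walk c z (segEnd (rank i) (2 * k - y)) ∧
      (rank i ≠ 0 → ∀ q, 2 * k - y ≤ q → q < 2 * k → (entry c z (q + 1)).idx ≠ rank i))

namespace IsRun

theorem retreat_zero (h : IsRun p c rank z s) (hB : ∀ i, Boundary c rank z (2 * k) i)
    (i : Fin k) : Retreating c rank z 0 i := by
  have hb := h.basic (t := 64 * k) le_rfl i
  have hBi := hB i
  have e : 32 * (2 * k) = 64 * k := by omega
  refine ⟨hb.k, hb.rk, ?_, Or.inr ⟨hb.st, hb.t, ?_, fun _ q h1 h2 => by omega⟩⟩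
  · have := hBi.hist
    rwa [e] at this
  · have := hBi.pos
    rwa [e] at this

/-- The agents of the group read the step to be undone from the guide's memory. -/
theorem sup_guide (h : IsRun p c rank z s)
    (hw : IsDFSWalk p k (walk c z) (entry c z) (count c z) (2 * k)) {y : ℕ} (hy : y < 2 * k)
    (hR : ∀ i, Retreating c rank z y i) {i : Fin k}
    (hi : (c (64 * k + y)).pos i = walk c z (2 * k - y)) (f : Entry → ℕ) :
    (((c (64 * k + y)).view i).sup fun s =>
      if (mem s).rk = (2 * k - y - 1) / 4 then f (mem s).undo else 0) =
      f (entry c z (2 * k - y)) := by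
  obtain ⟨g, hg⟩ := h.exists_rank (r := (2 * k - y - 1) / 4) (by omega)
  have hRg := hR g
  obtain ⟨hst, ht, hpos, -⟩ : _ ∧ _ ∧ _ ∧ _ := by
    -- The guide cannot have settled: its node would come from a step `q + 1` with `q + 2 ≤ 2 * rank
    -- g`, while only steps with `q ≥ 2 * k - y ≥ 4 * rank g + 1` have been undone.
    refine hRg.cases.resolve_left ?_
    rintro ⟨-, h0, q, hq1, hq2, hq3, -⟩
    obtain ⟨h1, -, -, -, -, h2⟩ := hw.fresh q hq2 (by omega)
    omega
  have hundo : (mem ((c (64 * k + y)).state g)).undo = entry c z (2 * k - y) := by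
    rw [Mem.undo, Mem.guide, Mem.left, hRg.card, hRg.hist, ht,
      show 66 * k - (64 * k + y) = 2 * k - y by omega, ← hg, ← segEnd, segment_getD]
    · congr 1
      unfold segEnd; omega
    · unfold segEnd; omega
  have hmem : (c (64 * k + y)).state g ∈ (c (64 * k + y)).view i := by
    refine mem_view.mpr ⟨g, ?_, rfl⟩
    rw [hpos, hi]
    congr 1
    unfold segEnd; omega
  apply le_antisymm
  · refine Finset.sup_le fun x hx => ?_
    obtain ⟨j, -, rfl⟩ := mem_view.mp hx
    split_ifs with hr
    · rw [(hR j).rk, ← hg] at hr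
      rw [h.inj hr, hundo]
    · exact Nat.zero_le _
  · refine le_trans ?_ (Finset.le_sup hmem)
    rw [if_pos (by rw [hRg.rk, hg]), hundo]

theorem retreat_succ (h : IsRun p c rank z s)
    (hw : IsDFSWalk p k (walk c z) (entry c z) (count c z) (2 * k)) {y : ℕ} (hy : y < 2 * k)
    (hR : ∀ i, Retreating c rank z y i) (i : Fin k) : Retreating c rank z (y + 1) i := by
  have hk := h.pos_k
  have hRi := hR i
  have hms := h.mem_succ (64 * k + y) i
  have hps := h.pos_succ (64 * k + y) i
  rw [act, if_neg (by rw [hRi.card]; omega), Nat.add_assoc] at hms hps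
  rcases hRi.cases with ⟨hst, h0, q, hq1, hq2, hq3, hq4⟩ | ⟨hst, ht, hpos, hidx⟩
  · rw [if_pos hst] at hms hps
    rw [nbr_zero] at hps
    refine ⟨by rw [hms]; exact hRi.card, by rw [hms]; exact hRi.rk, by rw [hms]; exact hRi.hist,
      Or.inl ⟨by rw [hms]; exact hst, h0, q, by omega, hq2, hq3, by rw [hps, hq4]⟩⟩
  · have hguide : (mem ((c (64 * k + y)).state i)).guide = (2 * k - y - 1) / 4 := by
      rw [Mem.guide, Mem.left, hRi.card, ht]; omega
    rw [if_neg (by rw [hst]; decide), if_neg (by rw [hRi.card, ht]; omega),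
      if_pos (by rw [hRi.card, ht]; omega), Mem.retreat, hguide, hRi.rk] at hms hps
    have e : 2 * k - (y + 1) + 1 = 2 * k - y := by omega
    by_cases hlt : rank i < (2 * k - y - 1) / 4
    · rw [if_pos hlt] at hms hps
      rw [nbr_zero, hpos] at hps
      refine ⟨by rw [hms]; exact hRi.card, by rw [hms]; exact hRi.rk, by rw [hms]; exact hRi.hist,
        Or.inr ⟨by rw [hms]; exact hst, by rw [hms]; exact congrArg (· + 1) ht, ?_, ?_⟩⟩
      · rw [hps]
        congr 1
        unfold segEnd; omega
      · intro h0 q h1 h2 h3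
        by_cases hq : q = 2 * k - (y + 1)
        · obtain ⟨f1, -, -, -, -, f2⟩ := hw.fresh q h2 (by omega)
          omega
        · exact hidx h0 q (by omega) h2 h3
    · have hpos' : (c (64 * k + y)).pos i = walk c z (2 * k - y) := by
        rw [hpos]
        congr 1
        unfold segEnd; omega
      rw [if_neg hlt, h.sup_guide hw hy hR hpos' Entry.idx,
        h.sup_guide hw hy hR hpos' Entry.inn] at hms hps
      by_cases hset : rank i ≠ 0 ∧ (entry c z (2 * k - y)).idx = rank i
      · rw [if_pos hset] at hms hps
        rw [nbr_zero, hpos'] at hps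
        refine ⟨by rw [hms]; exact hRi.card, by rw [hms], by rw [hms]; exact hRi.hist,
          Or.inl ⟨by rw [hms], hset.1, 2 * k - (y + 1), le_rfl, by omega, ?_, ?_⟩⟩
        · rw [e]; exact hset.2
        · rw [e]; exact hps
      · rw [if_neg hset] at hms hps
        have hb := hw.back (2 * k - (y + 1)) (by omega)
        rw [e] at hb
        dsimp only at hps
        rw [hpos', ← hb] at hps
        refine ⟨by rw [hms]; exact hRi.card, by rw [hms]; exact hRi.rk, by rw [hms]; exact hRi.hist,
          Or.inr ⟨by rw [hms]; exact hst, by rw [hms]; exact congrArg (· + 1) ht, ?_, ?_⟩⟩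
        · rw [hps]
          congr 1
          unfold segEnd; omega
        · intro h0 q h1 h2 h3
          by_cases hq : q = 2 * k - (y + 1)
          · rw [hq, e] at h3
            exact hset ⟨h0, h3⟩
          · exact hidx h0 q (by omega) h2 h3

theorem retreating (h : IsRun p c rank z s) (hG : G.Connected) (hk : k ≤ Fintype.card V) {y : ℕ}
    (hy : y ≤ 2 * k) (i : Fin k) : Retreating c rank z y i := by
  obtain ⟨hw, hB⟩ := h.dfs hG hk le_rfl
  induction y generalizing i with
  | zero => exact h.retreat_zero hB i
  | succ y ih => exact h.retreat_succ hw (by omega) (fun i => ih (by omega) i) i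

/-- In the end the agent of rank `r` is on the node with index `r`. -/
theorem final_pos (h : IsRun p c rank z s) (hG : G.Connected) (hk : k ≤ Fintype.card V)
    (i : Fin k) :
    (rank i = 0 ∧ (c (66 * k)).pos i = walk c z 0) ∨
      ∃ q < 2 * k, (entry c z (q + 1)).idx ≠ 0 ∧ (entry c z (q + 1)).idx = rank i ∧
        (c (66 * k)).pos i = walk c z (q + 1) := by
  obtain ⟨hw, -⟩ := h.dfs hG hk le_rfl
  have hR := (h.retreating hG hk le_rfl i).cases
  rw [show 64 * k + 2 * k = 66 * k by omega, Nat.sub_self] at hR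
  rcases hR with ⟨-, h0, q, -, hq2, hq3, hq4⟩ | ⟨-, -, hpos, hidx⟩
  · exact Or.inr ⟨q, hq2, by omega, hq3, hq4⟩
  · left
    have h0 : rank i = 0 := by
      by_contra h0
      -- Since the count reaches `k`, every index from 1 to `k - 1` occurs, so a nonzero rank must
      -- have settled.
      obtain ⟨q, hq, hqr⟩ := hw.exists_idx h.count_zero (r := rank i) (by omega)
        (by rw [hw.complete]; exact h.lt i)
      exact hidx h0 q (by omega) hq hqr
    refine ⟨h0, ?_⟩
    rw [hpos]
    congr 1

/-- Discovery steps lead to nodes not visited before, so two agents on one node share the discovery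
step, hence the index, hence the rank. -/
theorem final_injective (h : IsRun p c rank z s) (hG : G.Connected) (hk : k ≤ Fintype.card V) :
    Function.Injective (c (66 * k)).pos := by
  obtain ⟨hw, -⟩ := h.dfs hG hk le_rfl
  intro i j hij
  apply h.inj
  rcases h.final_pos hG hk i with ⟨hi, hip⟩ | ⟨q, hq, hq0, hqi, hip⟩ <;>
    rcases h.final_pos hG hk j with ⟨hj, hjp⟩ | ⟨q', hq', hq0', hqj, hjp⟩ <;> rw [hip, hjp] at hij
  · rw [hi, hj]
  · exact absurd ⟨0, by omega, hij⟩ (hw.fresh q' hq' hq0').2.2.1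
  · exact absurd ⟨0, by omega, hij.symm⟩ (hw.fresh q hq hq0).2.2.1
  · rcases Nat.lt_trichotomy q q' with hlt | rfl | hlt
    · exact absurd ⟨q + 1, by omega, hij⟩ (hw.fresh q' hq' hq0').2.2.1
    · rw [← hqi, ← hqj]
    · exact absurd ⟨q' + 1, by omega, hij.symm⟩ (hw.fresh q hq hq0).2.2.1

theorem final_const (h : IsRun p c rank z s) (hG : G.Connected) (hk : k ≤ Fintype.card V)
    (t : ℕ) : (c (66 * k + t)).pos = (c (66 * k)).pos := by
  have hk0 := h.pos_k
  have key : ∀ t i, (c (66 * k + t)).pos i = (c (66 * k)).pos i ∧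
      mem ((c (66 * k + t)).state i) = mem ((c (66 * k)).state i) := by
    intro t i
    induction t with
    | zero => exact ⟨rfl, rfl⟩
    | succ t ih =>
      have hR := h.retreating hG hk le_rfl i
      have hRk := hR.card
      have hRc := hR.cases
      rw [show 64 * k + 2 * k = 66 * k by omega] at hRk hRc
      rw [← Nat.add_assoc, h.pos_succ, h.mem_succ, act, ih.1, ih.2,
        if_neg (by rw [hRk]; omega)]
      rcases hRc with ⟨hst, -⟩ | ⟨hst, ht, -⟩
      · rw [if_pos hst]
        exact ⟨nbr_zero _ _, rfl⟩
      · rw [if_neg (by rw [hst]; decide), if_neg (by rw [hRk, ht]; omega),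
          if_neg (by rw [hRk, ht]; omega)]
        exact ⟨nbr_zero _ _, rfl⟩
  exact funext fun i => (key t i).1

end IsRun

/-! ### The first round -/

/-- The number of agents with a smaller identifier. -/
def idRank (ID : Fin k → ℕ) (i : Fin k) : ℕ := (Finset.univ.filter fun j => ID j < ID i).card

theorem idRank_lt (ID : Fin k → ℕ) (i : Fin k) : idRank ID i < k := by
  have : (Finset.univ.filter fun j => ID j < ID i) ⊂ Finset.univ :=
    Finset.filter_ssubset.mpr ⟨i, Finset.mem_univ _, by simp⟩
  simpa [idRank] using Finset.card_lt_card this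

theorem idRank_injective {ID : Fin k → ℕ} (hID : Function.Injective ID) :
    Function.Injective (idRank ID) := by
  have mono : ∀ i j, ID i < ID j → idRank ID i < idRank ID j := by
    intro i j hij
    refine Finset.card_lt_card (Finset.ssubset_iff_of_subset ?_ |>.mpr ⟨i, ?_, ?_⟩)
    · intro l hl
      simp only [Finset.mem_filter, Finset.mem_univ, true_and] at hl ⊢
      omega
    · simpa using hij
    · simp
  intro i j hij
  by_contra hne
  rcases Nat.lt_or_gt_of_ne (fun h => hne (hID h)) with h | h
  · exact (mono i j h).ne hij
  · exact (mono j i h).ne' hij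

/-- Views are sets of states; distinct identifiers make the states distinct, so their cardinalities
count agents. -/
theorem exists_isRun (p : PortLabeling G) (s : V) {ID : Fin k → ℕ} (hID : Function.Injective ID)
    (hk : 0 < k) :
    ∃ z, IsRun p (fun t => alg.run p (Config.rooted s ID) (t + 1)) (idRank ID) z s := by
  have hinj : Function.Injective (Config.rooted s ID).state := fun a b hab =>
    hID (congrArg AgentState.id hab)
  have hview : ∀ i, (Config.rooted s ID).view i =
      Finset.univ.image (Config.rooted s ID).state := by
    intro i; simp [Config.view, Config.rooted]
  have hact : ∀ i, act (G.degree ((Config.rooted s ID).pos i)) ((Config.rooted s ID).state i)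
      ((Config.rooted s ID).view i) =
      ({ (default : Mem) with k := k, rk := idRank ID i, x := 1 }, 0) := by
    intro i
    have h0 : (mem ((Config.rooted s ID).state i)).k = 0 := by
      simp [mem, Config.rooted, default]
    rw [act, if_pos h0, start, hview, Finset.filter_image, Finset.card_image_of_injective _ hinj,
      Finset.card_image_of_injective _ hinj]
    simp only [idRank, Config.rooted, Finset.card_univ, Fintype.card_fin]
    congr
  let f : Fin k → Fin k := fun i => ⟨idRank ID i, idRank_lt ID i⟩
  have hf : Function.Injective f := fun a b hab => idRank_injective hID (by simpa [f] using hab)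
  obtain ⟨z, hz⟩ := (Finite.injective_iff_surjective.mp hf) ⟨k - 1, by omega⟩
  refine ⟨z, ⟨fun t => ?_, idRank_injective hID, idRank_lt ID, by simpa [f] using hz, fun i => ?_,
    fun i => ?_⟩⟩
  · simp only [SyncAlgorithm.run]
    rw [Function.iterate_succ_apply']
  · change p.nbr _ (act _ _ _).2 = s
    rw [hact, nbr_zero]
    rfl
  · change Mem.decode (Mem.encode (act _ _ _).1) = _
    rw [hact, Mem.decode_encode]

theorem solves (p : PortLabeling G) (s : V) {ID : Fin k → ℕ} (hID : Function.Injective ID)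
    (hG : G.Connected) (hk : k ≤ Fintype.card V) :
    alg.SolvesDispersionWithin p (Config.rooted s ID) (67 * k) := by
  rcases Nat.eq_zero_or_pos k with rfl | hk0
  · exact ⟨0, le_rfl, fun i => i.elim0, fun t _ => funext fun i => i.elim0⟩
  · obtain ⟨z, h⟩ := exists_isRun p s hID hk0
    -- The extra round is the ranking round, and `66 * k + 1 ≤ 67 * k` as `k` is positive.
    refine ⟨66 * k + 1, by omega, h.final_injective hG hk, fun t ht => ?_⟩
    have := h.final_const hG hk (t - (66 * k + 1))
    rwa [show 66 * k + (t - (66 * k + 1)) + 1 = t by omega] at this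

end Retreat

end RootedDispersion

theorem mainTheorem1 :
    ∃ (A : SyncAlgorithm) (C : ℕ), ∀ c : ℕ, ∃ M : ℕ,
      ∀ (V : Type*) [Fintype V] [DecidableEq V] (G : SimpleGraph V) [DecidableRel G.Adj]
        (p : PortLabeling G) (k : ℕ) (s : V) (ID : Fin k → ℕ),
        G.Connected → k ≤ Fintype.card V →
        Function.Injective ID → (∀ i, ID i ∈ Set.Icc 1 (k ^ c)) →
        A.SolvesDispersionWithin p (Config.rooted s ID) (C * k) ∧
          A.UsesMemory p (Config.rooted s ID) (M * (Nat.log 2 (k + G.maxDegree) + 1)) := by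
  refine ⟨RootedDispersion.alg, 67, fun c => ⟨c + 500, ?_⟩⟩
  intro V _ _ G _ p k s ID hG hk hinj hID
  exact ⟨RootedDispersion.solves p s hinj hG hk, RootedDispersion.usesMemory c p s ID hID⟩
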